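/- **Setting.** A near superalgebra is a finite dimensional real superalgebra $\mathcal P=\mathcal P_0\oplus\mathcal P_1$ that is commutative (in the super sense) and local with residue field $\mathbb R$; $\mathbf b:\mathcal P\to\mathbb R$ is the projection to the residue field. Let $V=V_0\oplus V_1$ be a real symplectic supervector space of dimension $(m,n)$ with $n$ even: $V_0$ and $V_1$ are orthogonal for the form $\mathbf B$, which is non-degenerate, skew-symmetric on $V_0$ and symmetric on $V_1$. Fix an oriented symplectic basis $(e_1,\dots,e_m,f_1,\dots,f_n)$ of $V\otimes\mathbb C$: $(e_i)$ is a basis of $V_0$ with $\mathbf B(e_1,e_2)=\mathbf B(e_3,e_4)=\dots=1$ and all other pairs orthogonal, $(f_j)$ is an orthonormal basis of $V_1\otimes\mathbb C$ with each $f_j\in V_1\cup iV_1$, and the product $\xi^1\cdots\xi^n$ of the dual coordinates is the given orientation of $V_1$. Let $(x^i,\xi^j)$ be the dual coordinates. The Liouville integral $\int_V d_V(v)\,\phi(v)$ of $\phi=\sum_J\xi^J\phi_J(x)$ is $(-1)^{n(n-1)/2}(2\pi)^{-m/2}\int_{\mathbb R^m}\phi_{(1,\dots,1)}(x)\,dx^1\cdots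 dx^m$; it depends only on $\mathbf B$ and the orientation. Put $\int_{V_0}d_{V_0}=(2\pi)^{-m/2}\int_{\mathbb R^m}dx^1\cdots dx^m$. A point $X=\begin{pmatrix}A&B\\ C&D\end{pmatrix}$ of $\mathfrak{spo}(V)_{\mathcal P}=(\mathfrak{spo}(V)\otimes\mathcal P)_0$ has blocks $A\in\mathfrak{sp}(V_0)\otimes\mathcal P_0$, $D\in\mathfrak{so}(V_1)\otimes\mathcal P_0$ and $(B,C)\in\mathfrak{spo}(V)_1\otimes\mathcal P_1$. It belongs to $\mathfrak{spo}(V)_{\mathcal P}(\mathcal V^+)$ if the quadratic form $v\mapsto\mathbf B(v,\mathbf b(A)v)$ on $V_0$ is positive definite. For such $X$ the superPfaffian is $$\operatorname{Spf}(X)=\int_V d_V(v)\exp\bigl(-\tfrac12\mathbf B(v,Xv)\bigr)\in\mathcal P\otimes\mathbb C .$$ **Notation.** Let $\mathcal J_n=\{0,1\}^n$. We identify $J\in\mathcal J_n$ with the subset $\{j_1<\dots<j_r\}$ of $\{1,\dots,n\}$ where it equals $1$; $J'=\{j'_1<\dots<j'_{n-r}\}$ is the complement, $|J|=r$, and $\varepsilon(J,J')$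 is the signature of the permutation $(1,\dots,n)\mapsto(j_1,\dots,j_r,j'_1,\dots,j'_{n-r})$. For $I\in\mathbb N^m$ put $|I|=\sum_k i_k$, $I!=\prod_k i_k!$ and $x^I=\prod_k (x^k)^{i_k}$. * The matrices of $C$ and $D$ are taken in the basis $(e_i,f_j)$: $Ce_i=\sum_j f_jC_{ji}$ and $Df_k=\sum_j f_jD_{jk}$, with entries in $\mathcal P\otimes\mathbb C$. * $D_{J'}$ is the submatrix of $D$ of rows and columns in $J'$. For an antisymmetric $r\times r$ matrix $M$ with commuting entries, $\operatorname{Pfaff}(M)=\frac1{2^{r/2}(r/2)!}\sum_{\sigma\in\mathfrak S_r}\operatorname{sgn}(\sigma)\prod_{k=1}^{r/2}M_{\sigma(2k),\sigma(2k-1)}$ if $r$ is even (so that $\operatorname{Pfaff}\begin{pmatrix}0&-c\\ c&0\end{pmatrix}=c$), and $\operatorname{Pfaff}(M)=0$ if $r$ is odd. * $C_{J,I}$ is the $|J|\times|I|$ matrix obtained from $C$ by keeping the rows with index in $J$ and repeating the $k$-th column $i_k$ times. For an $r\times r$ matrix $M=(a_{p,q})$, $\phi_r(M)=\sum_{\sigma\in\mathfrak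 S_r}a_{1,\sigma(1)}\cdots a_{r,\sigma(r)}$. Put $c_{I,J}(C)=0$ if $|I|\ne|J|$ and $c_{I,J}(C)=(-1)^{|J|(|J|-1)/2}\,\frac1{I!}\,\phi_{|J|}(C_{J,I})$ if $|I|=|J|$. * $\tilde c_I(A)=\int_{V_0}d_{V_0}(v_0)\,x^I(v_0)\exp\bigl(-\tfrac12\mathbf B(v_0,Av_0)\bigr)\in\mathcal P$. **Proposition.** Let $\mathcal P$ be a near superalgebra and let $\begin{pmatrix}A&B\\ C&D\end{pmatrix}\in\mathfrak{spo}(V)_{\mathcal P}(\mathcal V^+)$. Then the integrals defining $\operatorname{Spf}$ and all the $\tilde c_I(A)$ converge absolutely, and $$\operatorname{Spf}\begin{pmatrix}A&B\\ C&D\end{pmatrix}=\sum_{\substack{(I,J)\in\mathbb N^m\times\mathcal J_n\\ |I|=|J|\ \text{even}}}(-1)^{\frac{|J|(|J|-1)}2}\,\varepsilon(J,J')\,c_{I,J}(C)\,\operatorname{Pfaff}(D_{J'})\,\tilde c_I(A).$$ -/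

import Mathlib

open scoped TensorProduct

noncomputable section

namespace SuperPfaffian

/-! ### Symplectic supervector spaces and their symplectic bases -/

/-- A symplectic form on the real supervector space with even part `V0` and odd part `V1`: an even
non-degenerate skew (in the super sense) bilinear form. The two parts are orthogonal, so it is given
by its restrictions to `V0` (skew-symmetric) and to `V1` (symmetric). -/
structure SymplecticForm (V0 V1 : Type*) [AddCommGroup V0] [Module ℝ V0]
    [AddCommGroup V1] [Module ℝ V1] where
  /-- the restriction to the even part -/
  B0 : LinearMap.BilinForm ℝ V0
  /-- the restriction to the odd part -/
  B1 : LinearMap.BilinForm ℝ V1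
  alt : B0.IsAlt
  symm : B1.IsSymm
  nondegenerate0 : B0.Nondegenerate
  nondegenerate1 : B1.Nondegenerate

/-- A symplectic basis `(e_1, …, e_m, f_1, …, f_n)` of a symplectic supervector space: `e` is a
symplectic basis of `V0` (with indices starting at `0`, `B(e_0, e_1) = B(e_2, e_3) = … = 1`, and the
other pairs are orthogonal) and `f` is an orthonormal basis of the complexification of `V1` such
that every `f_j` lies in `V1` or in `i V1`. The vector `f_j` is recorded as `s_j • g_j`, where
`g_j` is in `V1` and `s_j` is `1` or `i`. -/
structure SymplecticBasis {V0 V1 : Type*} [AddCommGroup V0] [Module ℝ V0]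
    [AddCommGroup V1] [Module ℝ V1] (F : SymplecticForm V0 V1) (m n : ℕ) where
  e : Module.Basis (Fin m) ℝ V0
  g : Module.Basis (Fin n) ℝ V1
  s : Fin n → ℂ
  e_symplectic : ∀ i j : Fin m, F.B0 (e i) (e j) =
    if Even i.val ∧ j.val = i.val + 1 then 1
    else if Even j.val ∧ i.val = j.val + 1 then -1
    else 0
  s_eq : ∀ j, s j = 1 ∨ s j = Complex.I
  f_orthonormal : ∀ j k : Fin n,
    s j * s k * (F.B1 (g j) (g k) : ℂ) = if j = k then 1 else 0

section Basis

variable {V0 V1 : Type*} [AddCommGroup V0] [Module ℝ V0] [AddCommGroup V1] [Module ℝ V1]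
  {F : SymplecticForm V0 V1} {m n : ℕ}

/-- The orientation of `V1` defined by a symplectic basis: the element `ξ^1 ⋯ ξ^n` of the
complexified exterior algebra of `V1^*`, where `ξ^j = s_j⁻¹ η^j` is the basis dual to
`f_j = s_j g_j` and `η^j` is the basis dual to `g_j`. -/
def SymplecticBasis.orientation (b : SymplecticBasis F m n) :
    ℂ ⊗[ℝ] ExteriorAlgebra ℝ (Module.Dual ℝ V1) :=
  (∏ j, b.s j)⁻¹ ⊗ₜ[ℝ] ExteriorAlgebra.ιMulti ℝ n (fun j => b.g.coord j)

/-- The linear form "coefficient of `ξ^1 ⋯ ξ^n`" on the exterior algebra of `V1^*`. -/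
def SymplecticBasis.topCoeff (b : SymplecticBasis F m n) :
    ExteriorAlgebra ℝ (Module.Dual ℝ V1) →ₗ[ℝ] ℂ :=
  (LinearMap.toSpanSingleton ℝ ℂ (∏ j, b.s j)).comp
    (ExteriorAlgebra.liftAlternating (R := ℝ)
      (Pi.single (M := fun k => Module.Dual ℝ V1 [⋀^Fin k]→ₗ[ℝ] ℝ) n b.g.dualBasis.det))

/-- The point `∑ x^i e_i` of `V0` with coordinates `x`. -/
def SymplecticBasis.point (b : SymplecticBasis F m n) (x : Fin m → ℝ) : V0 :=
  ∑ i, x i • b.e i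

end Basis

/-! ### Integrals with values in a finite dimensional space, and the exponential -/

/-- Convergence of an integral over `ℝ^m` with values in a real vector space. -/
def WeaklyIntegrable {m : ℕ} {E : Type*} [AddCommGroup E] [Module ℝ E]
    (f : (Fin m → ℝ) → E) : Prop :=
  ∀ φ : Module.Dual ℝ E, MeasureTheory.Integrable (fun x => φ (f x))

/-- The integral over `ℝ^m` of a function with values in a finite dimensional real vector space,
computed coordinate by coordinate. -/
def weakIntegral {m : ℕ} {E : Type*} [AddCommGroup E] [Module ℝ E] [FiniteDimensional ℝ E]
    (f : (Fin m → ℝ) → E) : E :=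
  ∑ k, (∫ x, (Module.finBasis ℝ E).repr (f x) k) • Module.finBasis ℝ E k

/-- The exponential of an element `a` of a real algebra with respect to a body map `β`, for `a` with
nilpotent soul `a - β a`: the Taylor expansion of `exp` at the real number `β a`. -/
def superExp {R : Type*} [Ring R] [Algebra ℝ R] (β : R →ₗ[ℝ] ℝ) (a : R) : R :=
  Real.exp (β a) •
    ∑ k ∈ Finset.range (nilpotencyClass (a - algebraMap ℝ R (β a))),
      ((k.factorial : ℝ)⁻¹) • (a - algebraMap ℝ R (β a)) ^ k

/-! ### Near superalgebras -/

/-- A superalgebra `P` (with grading `𝒢`) that is finite dimensional is *near* if it is commutative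
in the super sense and local with residue field `ℝ`. The canonical projection to the residue field
is the (unique) algebra homomorphism `β` to `ℝ`, the body map. -/
structure IsNear {P : Type*} [Ring P] [Algebra ℝ P] [FiniteDimensional ℝ P]
    (𝒢 : ZMod 2 → Submodule ℝ P) [GradedAlgebra 𝒢] (_β : P →ₐ[ℝ] ℝ) : Prop where
  even_comm : ∀ a ∈ 𝒢 0, ∀ c : P, a * c = c * a
  odd_anticomm : ∀ a ∈ 𝒢 1, ∀ c ∈ 𝒢 1, a * c = -(c * a)
  isLocalRing : IsLocalRing P

/-! ### The points of `spo(V)` with values in a superalgebra -/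

section Spo

variable {V0 V1 : Type*} [AddCommGroup V0] [Module ℝ V0] [AddCommGroup V1] [Module ℝ V1]

/-- The symplectic Lie algebra `sp(V0)`. -/
def sp (F : SymplecticForm V0 V1) : Submodule ℝ (V0 →ₗ[ℝ] V0) where
  carrier := {A | ∀ v w, F.B0 (A v) w + F.B0 v (A w) = 0}
  zero_mem' := by intro v w; simp
  add_mem' := by
    intro A A₂ h h₂ v w
    have := h v w
    have := h₂ v w
    simp only [LinearMap.add_apply, map_add]
    linarith
  smul_mem' := by
    intro c A h v w
    have := h v w
    simp only [LinearMap.smul_apply, map_smul, smul_eq_mul]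
    rw [← mul_add, this, mul_zero]

/-- The orthogonal Lie algebra `so(V1)`. -/
def so (F : SymplecticForm V0 V1) : Submodule ℝ (V1 →ₗ[ℝ] V1) where
  carrier := {D | ∀ v w, F.B1 (D v) w + F.B1 v (D w) = 0}
  zero_mem' := by intro v w; simp
  add_mem' := by
    intro A A₂ h h₂ v w
    have := h v w
    have := h₂ v w
    simp only [LinearMap.add_apply, map_add]
    linarith
  smul_mem' := by
    intro c A h v w
    have := h v w
    simp only [LinearMap.smul_apply, map_smul, smul_eq_mul]
    rw [← mul_add, this, mul_zero]

/-- The odd part of `spo(V)`: the pairs `(B, C)` of blocks `B : V1 → V0`, `C : V0 → V1` with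
`C = -B^*`, that is `B(C v, w) + B(v, B w) = 0` for `v` in `V0` and `w` in `V1`. -/
def spoOdd (F : SymplecticForm V0 V1) : Submodule ℝ ((V1 →ₗ[ℝ] V0) × (V0 →ₗ[ℝ] V1)) where
  carrier := {q | ∀ v w, F.B1 (q.2 v) w + F.B0 v (q.1 w) = 0}
  zero_mem' := by intro v w; simp
  add_mem' := by
    intro q q₂ h h₂ v w
    have := h v w
    have := h₂ v w
    simp only [Prod.fst_add, Prod.snd_add, LinearMap.add_apply, map_add]
    linarith
  smul_mem' := by
    intro c q h v w
    have := h v w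
    simp only [Prod.smul_fst, Prod.smul_snd, LinearMap.smul_apply, map_smul, smul_eq_mul]
    rw [← mul_add, this, mul_zero]

variable {P : Type*} [Ring P] [Algebra ℝ P]

/-- The `P`-valued points `spo(V)_P = (spo(V) ⊗ P)_0 = spo(V)_0 ⊗ P_0 ⊕ spo(V)_1 ⊗ P_1` of
`spo(V)`: the matrices with diagonal blocks `A`, `D` and off-diagonal blocks `BC = (B, C)`. -/
structure SpoPoint (F : SymplecticForm V0 V1) (𝒢 : ZMod 2 → Submodule ℝ P) where
  A : sp F ⊗[ℝ] 𝒢 0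
  D : so F ⊗[ℝ] 𝒢 0
  BC : spoOdd F ⊗[ℝ] 𝒢 1

/-- The linear map `x ⊗ p ↦ φ(x) p`. -/
def contract {M : Type*} [AddCommGroup M] [Module ℝ M] (S : Submodule ℝ P) (φ : M →ₗ[ℝ] ℝ) :
    M ⊗[ℝ] S →ₗ[ℝ] P :=
  (TensorProduct.lid ℝ P).toLinearMap.comp (TensorProduct.map φ S.subtype)

variable {F : SymplecticForm V0 V1} {𝒢 : ZMod 2 → Submodule ℝ P} {m n : ℕ}

/-- `B(v, A w)` for `v`, `w` in `V0`. -/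
def formA (A : sp F ⊗[ℝ] 𝒢 0) (v w : V0) : P :=
  contract (𝒢 0) ((F.B0 v).comp ((LinearMap.applyₗ w).comp (sp F).subtype)) A

/-- `B(v, D w)` for `v`, `w` in `V1`. -/
def formD (D : so F ⊗[ℝ] 𝒢 0) (v w : V1) : P :=
  contract (𝒢 0) ((F.B1 v).comp ((LinearMap.applyₗ w).comp (so F).subtype)) D

/-- `B(v, B w)` for `v` in `V0` and `w` in `V1`. -/
def formB (BC : spoOdd F ⊗[ℝ] 𝒢 1) (v : V0) (w : V1) : P :=
  contract (𝒢 1) ((F.B0 v).comp ((LinearMap.applyₗ w).comp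
    ((LinearMap.fst ℝ (V1 →ₗ[ℝ] V0) (V0 →ₗ[ℝ] V1)).comp (spoOdd F).subtype))) BC

/-- `B(v, C w)` for `v` in `V1` and `w` in `V0`. -/
def formC (BC : spoOdd F ⊗[ℝ] 𝒢 1) (v : V1) (w : V0) : P :=
  contract (𝒢 1) ((F.B1 v).comp ((LinearMap.applyₗ w).comp
    ((LinearMap.snd ℝ (V1 →ₗ[ℝ] V0) (V0 →ₗ[ℝ] V1)).comp (spoOdd F).subtype))) BC

/-- The entries, in the complexification of `P`, of the matrix of `D` in the basis `f`:
`D f_k = ∑ f_j D_{jk}`. -/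
def matD (b : SymplecticBasis F m n) (D : so F ⊗[ℝ] 𝒢 0) : Matrix (Fin n) (Fin n) (ℂ ⊗[ℝ] P) :=
  fun j k => ((b.s j)⁻¹ * b.s k) ⊗ₜ[ℝ] contract (𝒢 0)
    ((b.g.coord j).comp ((LinearMap.applyₗ (b.g k)).comp (so F).subtype)) D

/-- The entries, in the complexification of `P`, of the matrix of `C` in the bases `e` and `f`:
`C e_i = ∑ f_j C_{ji}`. -/
def matC (b : SymplecticBasis F m n) (BC : spoOdd F ⊗[ℝ] 𝒢 1) :
    Matrix (Fin n) (Fin m) (ℂ ⊗[ℝ] P) :=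
  fun j i => (b.s j)⁻¹ ⊗ₜ[ℝ] contract (𝒢 1)
    ((b.g.coord j).comp ((LinearMap.applyₗ (b.e i)).comp
      ((LinearMap.snd ℝ (V1 →ₗ[ℝ] V0) (V0 →ₗ[ℝ] V1)).comp (spoOdd F).subtype))) BC

/-- The body of `A`, an element of `sp(V0)`. -/
def bodyA (β : P →ₐ[ℝ] ℝ) (A : sp F ⊗[ℝ] 𝒢 0) : sp F :=
  TensorProduct.rid ℝ (sp F)
    ((β.toLinearMap.comp (𝒢 0).subtype).lTensor (sp F) A)

/-- The body of `X` lies in the open set `𝒱⁺ = 𝒰⁺ × so(V1)`: the quadratic form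
`v ↦ B(v, b(A) v)` on `V0` is positive definite. -/
def SpoPoint.InVPlus (β : P →ₐ[ℝ] ℝ) (X : SpoPoint F 𝒢) : Prop :=
  ∀ v : V0, v ≠ 0 → 0 < F.B0 v ((bodyA β X.A : V0 →ₗ[ℝ] V0) v)

end Spo

/-! ### The superPfaffian -/

section Spf

variable {V0 V1 : Type*} [AddCommGroup V0] [Module ℝ V0] [AddCommGroup V1] [Module ℝ V1]
  {P : Type*} [Ring P] [Algebra ℝ P]

/-- The superalgebra `Λ(V1^*) ⊗ P`, with the rule of signs in its product, in which the `P`-valued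
functions on the supermanifold `V` take their values at the points of `V0`. -/
abbrev FunAlg (V1 : Type*) [AddCommGroup V1] [Module ℝ V1] {P : Type*} [Ring P] [Algebra ℝ P]
    (𝒢 : ZMod 2 → Submodule ℝ P) [GradedAlgebra 𝒢] : Type _ :=
  GradedTensorProduct ℝ (CliffordAlgebra.evenOdd (0 : QuadraticForm ℝ (Module.Dual ℝ V1))) 𝒢

variable (𝒢 : ZMod 2 → Submodule ℝ P) [GradedAlgebra 𝒢]

/-- The element `η ⊗ 1`, for `η` a linear form on `V1`: an odd linear function on `V`. -/
def oddCoord (η : Module.Dual ℝ V1) : FunAlg V1 𝒢 :=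
  GradedTensorProduct.tmul ℝ (ExteriorAlgebra.ι ℝ η) (1 : P)

/-- The constant function `1 ⊗ p`. -/
def const (V1 : Type*) [AddCommGroup V1] [Module ℝ V1] (p : P) : FunAlg V1 𝒢 :=
  GradedTensorProduct.tmul ℝ (1 : ExteriorAlgebra ℝ (Module.Dual ℝ V1)) p

/-- The body map `Λ(V1^*) ⊗ P → ℝ`. -/
def funBody (β : P →ₐ[ℝ] ℝ) : FunAlg V1 𝒢 →ₗ[ℝ] ℝ :=
  ((TensorProduct.lid ℝ ℝ).toLinearMap.comp
    (TensorProduct.map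
      (ExteriorAlgebra.algebraMapInv (R := ℝ) (M := Module.Dual ℝ V1)).toLinearMap
      β.toLinearMap)).comp
    (GradedTensorProduct.of ℝ
      (CliffordAlgebra.evenOdd (0 : QuadraticForm ℝ (Module.Dual ℝ V1))) 𝒢).symm.toLinearMap

variable {𝒢} {F : SymplecticForm V0 V1} {m n : ℕ}

/-- The moment map `μ(X, v) = -1/2 B(v, X v)` at a point `v0` of `V0`. For a homogeneous basis
`(g_i)` of `V` with dual basis `(z^i)`, `v = ∑ g_i z^i` and `X = ∑ G_k Z^k` one has
`B(v, X v) = ∑ B(g_i, G_k g_j) z^j Z^k z^i`. Here the sums over the even basis vectors have been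
carried out and the four terms correspond to the blocks `A`, `C`, `B`, `D`. -/
def mu (b : SymplecticBasis F m n) (X : SpoPoint F 𝒢) (v0 : V0) : FunAlg V1 𝒢 :=
  (-(1 / 2) : ℝ) •
    (const 𝒢 V1 (formA X.A v0 v0)
      + ∑ i, const 𝒢 V1 (formC X.BC (b.g i) v0) * oddCoord 𝒢 (b.g.coord i)
      + ∑ j, oddCoord 𝒢 (b.g.coord j) * const 𝒢 V1 (formB X.BC v0 (b.g j))
      + ∑ i, ∑ j, oddCoord 𝒢 (b.g.coord j) * const 𝒢 V1 (formD X.D (b.g i) (b.g j))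
          * oddCoord 𝒢 (b.g.coord i))

/-- The Berezin integral on the odd part: `∑ ξ^J p_J ↦ (-1)^{n(n-1)/2} p_{(1,…,1)}`. -/
def berezin (b : SymplecticBasis F m n) : FunAlg V1 𝒢 →ₗ[ℝ] ℂ ⊗[ℝ] P :=
  ((-1 : ℝ) ^ (n * (n - 1) / 2)) •
    (b.topCoeff.rTensor P).comp
      (GradedTensorProduct.of ℝ
        (CliffordAlgebra.evenOdd (0 : QuadraticForm ℝ (Module.Dual ℝ V1))) 𝒢).symm.toLinearMap

/-- The function of the even coordinates `x` obtained by integrating `exp(μ(X, v))` over the odd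
variables. -/
def spfIntegrand (b : SymplecticBasis F m n) (β : P →ₐ[ℝ] ℝ) (X : SpoPoint F 𝒢)
    (x : Fin m → ℝ) : ℂ ⊗[ℝ] P :=
  berezin b (superExp (funBody 𝒢 β) (mu b X (b.point x)))

/-- The superPfaffian `Spf(X) = ∫_V d_V(v) exp(μ(X, v))`, where `d_V` is the Liouville integral:
`(2π)^{-m/2}` times Lebesgue measure in the even coordinates, the Berezin integral in the odd
ones. The basis `b` serves to write down `d_V`, which depends only on the symplectic form and on
the orientation. -/
def spf [FiniteDimensional ℝ P] (b : SymplecticBasis F m n) (β : P →ₐ[ℝ] ℝ)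
    (X : SpoPoint F 𝒢) : ℂ ⊗[ℝ] P :=
  ((2 * Real.pi) ^ (-(m : ℝ) / 2)) • weakIntegral (spfIntegrand b β X)

/-- The integrand `x^I exp(-1/2 B(v0, A v0))` of a Gaussian moment. -/
def momentIntegrand (b : SymplecticBasis F m n) (β : P →ₐ[ℝ] ℝ) (A : sp F ⊗[ℝ] 𝒢 0)
    (I : Fin m → ℕ) (x : Fin m → ℝ) : P :=
  (∏ i, x i ^ I i) •
    superExp β.toLinearMap ((-(1 / 2) : ℝ) • formA A (b.point x) (b.point x))

/-- The Gaussian moment `∫_{V0} d_{V0}(v0) x^I exp(-1/2 B(v0, A v0))`. -/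
def moment [FiniteDimensional ℝ P] (b : SymplecticBasis F m n) (β : P →ₐ[ℝ] ℝ)
    (A : sp F ⊗[ℝ] 𝒢 0) (I : Fin m → ℕ) : P :=
  ((2 * Real.pi) ^ (-(m : ℝ) / 2)) • weakIntegral (momentIntegrand b β A I)

end Spf

/-! ### The combinatorial ingredients of the expansion -/

section Combinatorics

variable {R : Type*} [Ring R] [Algebra ℝ R]

/-- The Pfaffian of an antisymmetric matrix with commuting entries, in the normalization
`Pfaff !![0, -c; c, 0] = c`, that is `∫ dξ exp(-1/2 ∑ M_{ij} ξ^j ξ^i)`. -/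
def pfaff {r : ℕ} (M : Matrix (Fin r) (Fin r) R) : R :=
  if Even r then
    ((2 ^ (r / 2) * (r / 2).factorial : ℝ)⁻¹) •
      ∑ σ : Equiv.Perm (Fin r), ((Equiv.Perm.sign σ : ℤ) : R) *
        (List.ofFn fun i : Fin (r / 2) =>
          M (σ ⟨2 * i.val + 1, by omega⟩) (σ ⟨2 * i.val, by omega⟩)).prod
  else 0

/-- `φ_r(M) = ∑_σ a_{1,σ(1)} ⋯ a_{r,σ(r)}`. -/
def phi {r : ℕ} (M : Matrix (Fin r) (Fin r) R) : R :=
  ∑ σ : Equiv.Perm (Fin r), (List.ofFn fun k => M k (σ k)).prod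

/-- The list in which the index `k` is written `I k` times, in increasing order. -/
def repeats {m : ℕ} (I : Fin m → ℕ) : List (Fin m) :=
  (List.finRange m).flatMap fun k => List.replicate (I k) k

theorem length_repeats {m : ℕ} (I : Fin m → ℕ) : (repeats I).length = ∑ k, I k := by
  simp [repeats, List.length_flatMap, List.sum_ofFn, ← List.ofFn_eq_map]

/-- The `|J| × |I|` matrix `C_{J,I}`: the rows of `C` with index in `J` are kept, and the column
with index `k` is kept `I k` times. -/
def repMatrix {m n : ℕ} (C : Matrix (Fin n) (Fin m) R) (J : Finset (Fin n)) (I : Fin m → ℕ) :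
    Matrix (Fin J.card) (Fin (∑ k, I k)) R :=
  fun p q => C (J.orderEmbOfFin rfl p) ((repeats I).get (q.cast (length_repeats I).symm))

/-- `c_{I,J}(C)`: zero for `|I| ≠ |J|`, and `(-1)^{|J|(|J|-1)/2} φ_{|J|}(C_{J,I}) / I!` for
`|I| = |J|`. -/
def coeffC {m n : ℕ} (C : Matrix (Fin n) (Fin m) R) (I : Fin m → ℕ) (J : Finset (Fin n)) : R :=
  if h : ∑ k, I k = J.card then
    ((-1 : ℝ) ^ (J.card * (J.card - 1) / 2) * (∏ k, ((I k).factorial : ℝ))⁻¹) •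
      phi ((repMatrix C J I).submatrix id (Fin.cast h.symm))
  else 0

/-- The submatrix `M_J` of rows and columns with index in `J`. -/
def subMatrix {n : ℕ} (M : Matrix (Fin n) (Fin n) R) (J : Finset (Fin n)) :
    Matrix (Fin J.card) (Fin J.card) R :=
  M.submatrix (J.orderEmbOfFin rfl) (J.orderEmbOfFin rfl)

/-- The permutation `(1, …, n) ↦ (j_1, …, j_r, j'_1, …, j'_{n-r})`, where `j_1 < … < j_r` are the
elements of `J` and `j'_1 < … < j'_{n-r}` those of its complement. -/
def shuffle {n : ℕ} (J : Finset (Fin n)) : Equiv.Perm (Fin n) :=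
  (finCongr (by simp [Finset.card_add_card_compl] : n = J.card + Jᶜ.card)).trans
    (finSumFinEquiv.symm.trans (finSumEquivOfFinset rfl rfl))

/-- `ε(J, J')`, for which `ε(J, J') ξ^J ξ^{J'} = ξ^1 ⋯ ξ^n`. -/
def eps {n : ℕ} (J : Finset (Fin n)) : ℝ := ((Equiv.Perm.sign (shuffle J) : ℤ) : ℝ)

end Combinatorics

end SuperPfaffian

end

noncomputable section

namespace SuperPfaffian

/-! ### Sums over functions between finite sets -/

/-! The exponent splits as `-1/2 B(v₀, A v₀) + ∑ η_j γ_j - 1/2 ∑ η_j D_ij η_i`, where the `η_j` are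
the odd coordinates dual to `g_j` and `γ_j = B(g_j, C v₀)` is odd in `P`. The blocks `B` and `C` are
adjoint up to sign, so the two mixed terms of `B(v, Xv)` agree and cancel the factor `1/2`
(`mu_eq`). The three summands are even, hence commute, and become nilpotent once the body of the
first is removed, so the exponential is a product (`superExp_mu`). Reordering anticommuting words
gives `exp(∑ η_j γ_j) = ∑_J ± η^J γ^J` (`nilExp_sum_mul`) and expresses the exponential of the
`D`-term as `∑_K ± η^K Pfaff(D_K)` (`nilExp_quadratic`).

The Berezin integral keeps only `K = J'`, with the sign `ε(J, J')`. Since `n` is even and odd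
Pfaffians vanish, `|J|` is even, and then all remaining signs multiply to one (`sign_eq_one`). Each
`γ_j` is linear in `x`; expanding `γ^J` and sorting by the multiplicities of the columns produces
`x^I` and `c_{I,J}(C)` (`monomial_sum_smul`). The phases `s_j` in the complex matrices multiply to
exactly the factor carried by the top coefficient.

It remains to integrate a finite sum over `x`. Each integrand is a scalar Gaussian times a
polynomial, because the soul of `A` is nilpotent and its body is positive definite. The left side is
written in another basis with the same orientation: the exponent is a contraction with the canonical
element of `V1 ⊗ V1^*`, the orientation fixes the top coefficient, and a symplectic change of basis
has determinant `±1`. -/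

/-- A sum over functions `Fin r → Fin n` that is supported on injective functions is a sum over
the images and the orderings of the images. -/
theorem sum_eq_sum_orderEmbOfFin_comp_perm {E : Type*} [AddCommMonoid E] {r n : ℕ}
    (G : (Fin r → Fin n) → E) (hG : ∀ h, ¬ Function.Injective h → G h = 0) :
    ∑ h, G h = ∑ K : {K : Finset (Fin n) // K.card = r}, ∑ σ : Equiv.Perm (Fin r),
      G (K.1.orderEmbOfFin K.2 ∘ σ) := by
  rw [← Fintype.sum_prod_type']
  symm
  refine Fintype.sum_of_injective
    (fun q : {K : Finset (Fin n) // K.card = r} × Equiv.Perm (Fin r) =>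
      (q.1.1.orderEmbOfFin q.1.2 ∘ q.2 : Fin r → Fin n)) ?_ _ _ ?_ (fun _ => rfl)
  · rintro ⟨⟨K, hK⟩, σ⟩ ⟨⟨K', hK'⟩, σ'⟩ h
    -- Passing to ranges forgets the permutation and recovers the subset.
    have hr := congrArg Set.range h
    simp only [EquivLike.range_comp, Finset.range_orderEmbOfFin] at hr
    obtain rfl := Finset.coe_injective hr
    congr
    ext p
    have := congrFun h p
    simp only [Function.comp_apply] at this
    exact congrArg Fin.val ((K.orderEmbOfFin hK).injective this)
  · intro h hh
    apply hG
    intro hinj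
    apply hh
    have hK : (Finset.univ.image h).card = r := by
      rw [Finset.card_image_of_injective _ hinj]; simp
    let K := Finset.univ.image h
    -- The permutation sends `p` to the rank of `h p` in the image of `h`.
    let s : Fin r → Fin r := fun p => (K.orderIsoOfFin hK).symm ⟨h p, by simp [K]⟩
    have hs : Function.Injective s := by
      intro p q hpq
      have := (K.orderIsoOfFin hK).symm.injective hpq
      exact hinj (congrArg Subtype.val this)
    refine ⟨⟨⟨K, hK⟩, Equiv.ofBijective s (Finite.injective_iff_bijective.mp hs)⟩, ?_⟩
    funext p
    simp only [Function.comp_apply, Equiv.ofBijective_apply, s]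
    rw [← Finset.coe_orderIsoOfFin_apply, OrderIso.apply_symm_apply]

/-- The number of times that each value is taken. -/
def fiberCard {r m : ℕ} (i : Fin r → Fin m) (k : Fin m) : ℕ := Fintype.card {p // i p = k}

theorem sum_fiberCard {r m : ℕ} (i : Fin r → Fin m) : ∑ k, fiberCard i k = r := by
  simp only [fiberCard]
  rw [← Fintype.card_sigma, Fintype.card_congr (Equiv.sigmaFiberEquiv i), Fintype.card_fin]

theorem exists_perm_comp_eq {r m : ℕ} {i ρ : Fin r → Fin m} (h : fiberCard i = fiberCard ρ) :
    ∃ σ : Equiv.Perm (Fin r), ρ ∘ σ = i := by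
  have e : ∀ k, {p // i p = k} ≃ {p // ρ p = k} := fun k =>
    Fintype.equivOfCardEq (congrFun h k)
  exact ⟨Equiv.ofFiberEquiv e, funext fun p => Equiv.ofFiberEquiv_map e p⟩

/-- Once `i = ρ ∘ τ`, right translation by `τ⁻¹` carries these permutations onto the stabilizer of
`ρ`, a Young subgroup. -/
theorem card_perm_comp_eq {r m : ℕ} {i ρ : Fin r → Fin m} (h : fiberCard i = fiberCard ρ) :
    (Finset.univ.filter fun σ : Equiv.Perm (Fin r) => ρ ∘ σ = i).card
      = ∏ k, (fiberCard ρ k).factorial := by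
  obtain ⟨τ, rfl⟩ := exists_perm_comp_eq h
  have := DomMulAct.stabilizer_card ρ
  simp only [fiberCard]
  rw [← this, Fintype.card_subtype]
  refine Finset.card_bij' (fun σ _ => σ * τ⁻¹) (fun σ _ => σ * τ) ?_ ?_ ?_ ?_
  · intro σ hσ
    simp only [Finset.mem_filter, Finset.mem_univ, true_and] at hσ ⊢
    funext p
    have := congrFun hσ (τ⁻¹ p)
    simpa using this
  · intro σ hσ
    simp only [Finset.mem_filter, Finset.mem_univ, true_and] at hσ ⊢
    funext p
    have := congrFun hσ (τ p)
    simpa using this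
  · intro σ _; simp
  · intro σ _; simp

theorem fiberCard_comp_perm {r m : ℕ} (ρ : Fin r → Fin m) (σ : Equiv.Perm (Fin r)) :
    fiberCard (ρ ∘ σ) = fiberCard ρ := by
  funext k
  exact Fintype.card_congr (σ.subtypeEquiv fun p => Iff.rfl)

/-- Summation of a function of `ρ ∘ σ` over the permutations `σ`. -/
theorem sum_perm_comp {E : Type*} [AddCommMonoid E] {r m : ℕ} (ρ : Fin r → Fin m)
    (G : (Fin r → Fin m) → E) :
    ∑ σ : Equiv.Perm (Fin r), G (ρ ∘ σ) = (∏ k, (fiberCard ρ k).factorial) •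
      ∑ i with fiberCard i = fiberCard ρ, G i := by
  rw [← Finset.sum_fiberwise_of_maps_to (s := Finset.univ)
    (t := Finset.univ.filter fun i => fiberCard i = fiberCard ρ)
    (g := fun σ : Equiv.Perm (Fin r) => ρ ∘ σ) (by intro σ _; simp [fiberCard_comp_perm]),
    Finset.smul_sum]
  refine Finset.sum_congr rfl fun i hi => ?_
  rw [← card_perm_comp_eq (i := i) (by simpa using hi), ← Finset.sum_const]
  refine Finset.sum_congr rfl fun σ hσ => ?_
  rw [(Finset.mem_filter.mp hσ).2]

/-- Shows that the column order of `repMatrix` is a valid representative of the multiplicities `I`,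
as `sum_eq_sum_piAntidiag` requires. -/
theorem fiberCard_repeats {r m : ℕ} (I : Fin m → ℕ) (h : ∑ k, I k = r) :
    fiberCard (fun p : Fin r =>
      (repeats I).get ((Fin.cast h.symm p).cast (length_repeats I).symm)) = I := by
  subst h
  funext k
  have h1 : fiberCard (fun p : Fin (∑ k, I k) =>
      (repeats I).get ((Fin.cast rfl p).cast (length_repeats I).symm)) k
      = (repeats I).count k := by
    have := Fin.card_filter_univ_eq_vector_get_eq_count k
      (⟨repeats I, length_repeats I⟩ : List.Vector (Fin m) _)
    rw [fiberCard, Fintype.card_subtype]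
    exact this
  rw [h1, repeats, List.count_flatMap]
  have : (List.count k ∘ fun j => List.replicate (I j) j) = fun j => if j = k then I j else 0 := by
    funext j
    simp [List.count_replicate]
  rw [this, ← List.ofFn_eq_map, List.sum_ofFn]
  simp

/-- A sum over functions `Fin r → Fin m`, sorted by the multiplicities of the values. -/
theorem sum_eq_sum_piAntidiag {E : Type*} [AddCommGroup E] [Module ℝ E] {r m : ℕ}
    (G : (Fin r → Fin m) → E) (H : (Fin m → ℕ) → E)
    (hH : ∀ I, ∑ k, I k = r → ∃ ρ : Fin r → Fin m, fiberCard ρ = I ∧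
      H I = ∑ σ : Equiv.Perm (Fin r), G (ρ ∘ σ)) :
    ∑ i, G i = ∑ I ∈ Finset.piAntidiag (Finset.univ : Finset (Fin m)) r,
      (∏ k, ((I k).factorial : ℝ))⁻¹ • H I := by
  rw [← Finset.sum_fiberwise_of_maps_to (s := Finset.univ)
    (t := Finset.piAntidiag (Finset.univ : Finset (Fin m)) r)
    (g := fun i : Fin r → Fin m => fiberCard i)
    (by intro i _; simpa using sum_fiberCard i)]
  refine Finset.sum_congr rfl fun I hI => ?_
  obtain ⟨ρ, hρ, hI'⟩ := hH I (by simpa using hI)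
  rw [hI', sum_perm_comp, hρ, ← Nat.cast_smul_eq_nsmul ℝ, smul_smul]
  push_cast
  rw [inv_mul_cancel₀ (by positivity), one_smul]

theorem prod_comp_eq_prod_pow_fiberCard {r m : ℕ} (ρ : Fin r → Fin m) (x : Fin m → ℝ) :
    ∏ p, x (ρ p) = ∏ k, x k ^ fiberCard ρ k := by
  rw [← Finset.prod_fiberwise' Finset.univ ρ x]
  refine Finset.prod_congr rfl fun k _ => ?_
  rw [Finset.prod_const, fiberCard, Fintype.card_subtype]

/-! ### Products of lists -/

section Products

theorem prod_ofFn_mul_of_commute {R : Type*} [Ring R] {r : ℕ} (x y : Fin r → R) (h : ∀ p q, Commute (y p) (x q)) :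
    (List.ofFn fun p => x p * y p).prod = (List.ofFn x).prod * (List.ofFn y).prod := by
  induction r with
  | zero => simp
  | succ r ih =>
    simp only [List.ofFn_succ, List.prod_cons]
    rw [ih _ _ fun p q => h _ _]
    have : Commute (y 0) (List.ofFn fun p : Fin r => x p.succ).prod :=
      Commute.list_prod_right _ _ fun z hz => by
        obtain ⟨p, rfl⟩ := List.mem_ofFn.mp hz
        exact h _ _
    rw [mul_assoc, ← mul_assoc (y 0), this.eq]
    simp only [mul_assoc]

variable {R : Type*} [Ring R] [Algebra ℝ R]

theorem prod_ofFn_sum {r : ℕ} {κ : Type*} [Fintype κ] (a : Fin r → κ → R) :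
    (List.ofFn fun p => ∑ k, a p k).prod
      = ∑ h : Fin r → κ, (List.ofFn fun p => a p (h p)).prod := by
  have := (MultilinearMap.mkPiAlgebraFin ℝ r R).map_sum (α := fun _ => κ) a
  simpa using this

theorem pow_sum {κ : Type*} [Fintype κ] (a : κ → R) (r : ℕ) :
    (∑ k, a k) ^ r = ∑ h : Fin r → κ, (List.ofFn fun p => a (h p)).prod := by
  rw [← prod_ofFn_sum]
  simp

theorem prod_ofFn_smul {r : ℕ} (c : Fin r → ℝ) (a : Fin r → R) :
    (List.ofFn fun p => c p • a p).prod = (∏ p, c p) • (List.ofFn a).prod := by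
  have := (MultilinearMap.mkPiAlgebraFin ℝ r R).map_smul_univ c a
  simpa using this

theorem mul_prod_ofFn_of_anticommute {r : ℕ} (y : R) (x : Fin r → R)
    (h : ∀ q, y * x q = -(x q * y)) :
    y * (List.ofFn x).prod = (-1 : ℝ) ^ r • ((List.ofFn x).prod * y) := by
  induction r with
  | zero => simp
  | succ r ih =>
    simp only [List.ofFn_succ, List.prod_cons]
    rw [← mul_assoc, h, neg_mul, mul_assoc, ih _ fun q => h _, pow_succ, mul_smul_comm]
    simp [mul_assoc]

/-- Each `y p` must cross every `x q` with `q > p`, which makes `r(r-1)/2` transpositions. -/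
theorem prod_ofFn_mul_of_anticommute {r : ℕ} (x y : Fin r → R)
    (h : ∀ p q, y p * x q = -(x q * y p)) :
    (List.ofFn fun p => x p * y p).prod
      = (-1 : ℝ) ^ (r * (r - 1) / 2) • ((List.ofFn x).prod * (List.ofFn y).prod) := by
  induction r with
  | zero => simp
  | succ r ih =>
    simp only [List.ofFn_succ, List.prod_cons]
    rw [ih _ _ fun p q => h _ _, mul_smul_comm, mul_assoc, ← mul_assoc (y 0),
      mul_prod_ofFn_of_anticommute _ _ fun q => h _ _]
    have e : (r + 1) * (r + 1 - 1) / 2 = r * (r - 1) / 2 + r := by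
      have := Nat.triangle_succ r
      simpa [mul_comm] using this
    rw [e, pow_add]
    simp only [mul_smul_comm, smul_mul_assoc, smul_smul, mul_assoc]

end Products

/-! ### Anticommuting families -/

section Anticommuting

/-- The monomial `θ_{j_1} ⋯ θ_{j_r}`, for `J = {j_1 < ⋯ < j_r}`. -/
def monomial {R : Type*} [Ring R] {n : ℕ} (θ : Fin n → R) (J : Finset (Fin n)) : R :=
  (List.ofFn fun p => θ (J.orderEmbOfFin rfl p)).prod

theorem prod_ofFn_orderEmbOfFin {R : Type*} [Ring R] {n : ℕ} (θ : Fin n → R) {J : Finset (Fin n)} {r : ℕ} (hJ : J.card = r) :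
    (List.ofFn fun p => θ (J.orderEmbOfFin hJ p)).prod = monomial θ J := by
  subst hJ; rfl

variable {R : Type*} [Ring R] [Algebra ℝ R] {n : ℕ} {θ : Fin n → R}

/-- Exchanging the two summation indices shows that the square is its own negative. Square zero is
what the universal property of the exterior algebra needs, so sign rules for words in `θ` follow
from those of alternating maps. -/
theorem sum_smul_mul_self_of_anticommute (hθ : ∀ i j, θ i * θ j = -(θ j * θ i)) (v : Fin n → ℝ) :
    (Fintype.linearCombination ℝ θ v) * (Fintype.linearCombination ℝ θ v) = 0 := by
  have h : ∀ a : R, a = -a → a = 0 := fun a ha => by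
    have : (2 : ℝ) • a = 0 := by rw [two_smul]; nth_rewrite 1 [ha]; simp
    simpa using this
  apply h
  simp only [Fintype.linearCombination_apply, Finset.sum_mul_sum]
  nth_rewrite 1 [Finset.sum_comm]
  simp only [← Finset.sum_neg_distrib]
  refine Finset.sum_congr rfl fun i _ => Finset.sum_congr rfl fun j _ => ?_
  simp only [smul_mul_assoc, mul_smul_comm]
  rw [hθ j i, smul_comm, smul_neg, smul_neg]

/-- The products of `r` elements of an anticommuting family, as an alternating map. -/
def anticommutingProd (hθ : ∀ i j, θ i * θ j = -(θ j * θ i)) (r : ℕ) :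
    (Fin n → ℝ) [⋀^Fin r]→ₗ[ℝ] R :=
  (ExteriorAlgebra.lift ℝ ⟨Fintype.linearCombination ℝ θ,
    sum_smul_mul_self_of_anticommute hθ⟩).toLinearMap.compAlternatingMap
      (ExteriorAlgebra.ιMulti ℝ r)

theorem anticommutingProd_apply (hθ : ∀ i j, θ i * θ j = -(θ j * θ i)) {r : ℕ}
    (h : Fin r → Fin n) :
    anticommutingProd hθ r (fun p => Pi.single (h p) 1) = (List.ofFn fun p => θ (h p)).prod := by
  simp only [anticommutingProd, LinearMap.compAlternatingMap_apply, ExteriorAlgebra.ιMulti_apply,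
    AlgHom.toLinearMap_apply, map_list_prod, List.map_ofFn, Function.comp_def,
    ExteriorAlgebra.lift_ι_apply, Fintype.linearCombination_apply_single, one_smul]

theorem prod_ofFn_comp_perm (hθ : ∀ i j, θ i * θ j = -(θ j * θ i)) {r : ℕ}
    (h : Fin r → Fin n) (σ : Equiv.Perm (Fin r)) :
    (List.ofFn fun p => θ (h (σ p))).prod
      = ((Equiv.Perm.sign σ : ℤ) : ℝ) • (List.ofFn fun p => θ (h p)).prod := by
  have := (anticommutingProd hθ r).map_perm (fun p => Pi.single (h p) 1) σ
  rw [anticommutingProd_apply] at this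
  rw [← anticommutingProd_apply hθ (fun p => h (σ p))]
  refine this.trans ?_
  rw [Int.cast_smul_eq_zsmul]
  rfl

theorem prod_ofFn_eq_zero_of_not_injective (hθ : ∀ i j, θ i * θ j = -(θ j * θ i)) {r : ℕ}
    (h : Fin r → Fin n) (hh : ¬ Function.Injective h) :
    (List.ofFn fun p => θ (h p)).prod = 0 := by
  rw [← anticommutingProd_apply hθ]
  apply AlternatingMap.map_eq_zero_of_not_injective
  intro hi
  exact hh fun p q hpq => hi (by simp [hpq])

end Anticommuting

/-! ### Exponentials of nilpotent elements -/

section NilExp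

variable {R : Type*} [Ring R] [Algebra ℝ R]

/-- The exponential of a nilpotent element of a real algebra. -/
def nilExp (a : R) : R :=
  ∑ k ∈ Finset.range (nilpotencyClass a), ((k.factorial : ℝ)⁻¹) • a ^ k

theorem superExp_eq (β : R →ₗ[ℝ] ℝ) (a : R) :
    superExp β a = Real.exp (β a) • nilExp (a - algebraMap ℝ R (β a)) := rfl

/-- Restricting scalars to `ℚ` gives access to the addition law of `IsNilpotent.exp`. -/
theorem nilExp_eq_exp (a : R) :
    nilExp a = @IsNilpotent.exp R _ (Module.compHom R (algebraMap ℚ ℝ)) a := by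
  let _ : Module ℚ R := Module.compHom R (algebraMap ℚ ℝ)
  rw [nilExp, IsNilpotent.exp]
  refine Finset.sum_congr rfl fun k _ => ?_
  change _ = (algebraMap ℚ ℝ (k.factorial : ℚ)⁻¹) • a ^ k
  simp

theorem nilExp_eq_sum {a : R} {N : ℕ} (h : a ^ N = 0) :
    nilExp a = ∑ k ∈ Finset.range N, ((k.factorial : ℝ)⁻¹) • a ^ k := by
  let _ : Module ℚ R := Module.compHom R (algebraMap ℚ ℝ)
  rw [nilExp_eq_exp, IsNilpotent.exp_eq_sum h]
  refine Finset.sum_congr rfl fun k _ => ?_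
  change (algebraMap ℚ ℝ (k.factorial : ℚ)⁻¹) • a ^ k = _
  simp

theorem nilExp_add {a c : R} (h : Commute a c) (ha : IsNilpotent a) (hc : IsNilpotent c) :
    nilExp (a + c) = nilExp a * nilExp c := by
  let _ : Module ℚ R := Module.compHom R (algebraMap ℚ ℝ)
  simp only [nilExp_eq_exp]
  exact IsNilpotent.exp_add_of_commute h ha hc

theorem map_nilExp {R' : Type*} [Ring R'] [Algebra ℝ R'] (f : R →ₐ[ℝ] R') {a : R}
    (ha : IsNilpotent a) : f (nilExp a) = nilExp (f a) := by
  obtain ⟨N, hN⟩ := ha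
  rw [nilExp_eq_sum hN, nilExp_eq_sum (N := N) (by rw [← map_pow, hN, map_zero])]
  simp

end NilExp

/-! ### Two exponentials of quadratic expressions in anticommuting families -/

section Exponentials

variable {R : Type*} [Ring R] [Algebra ℝ R] {n : ℕ}

theorem sum_range_sum_card {E : Type*} [AddCommMonoid E] (f : Finset (Fin n) → E) :
    ∑ r ∈ Finset.range (n + 1), ∑ K : {K : Finset (Fin n) // K.card = r}, f K.1
      = ∑ K, f K := by
  rw [← Finset.sum_fiberwise_of_maps_to (s := Finset.univ) (t := Finset.range (n + 1))
    (g := fun K : Finset (Fin n) => K.card)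
    (by intro K _; simpa [Nat.lt_succ_iff] using Finset.card_le_univ K)]
  refine Finset.sum_congr rfl fun r _ => ?_
  exact (Finset.sum_subtype (Finset.univ.filter fun K : Finset (Fin n) => K.card = r)
    (fun K => by simp) f).symm

theorem sign_mul_self_real {r : ℕ} (σ : Equiv.Perm (Fin r)) :
    ((Equiv.Perm.sign σ : ℤ) : ℝ) * ((Equiv.Perm.sign σ : ℤ) : ℝ) = 1 := by
  rw [← Int.cast_mul, ← Units.val_mul, Int.units_mul_self]; simp

variable {η γ : Fin n → R}

/-- Sorting a word produces the sign of the permutation twice, once from the `η` and once from the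
`γ`. The signs cancel, so each subset receives `r!` equal terms. -/
theorem sum_mul_pow (hη : ∀ i j, η i * η j = -(η j * η i)) (hγ : ∀ i j, γ i * γ j = -(γ j * γ i))
    (hγη : ∀ i j, γ i * η j = -(η j * γ i)) (r : ℕ) :
    (∑ j, η j * γ j) ^ r = (r.factorial : ℝ) • ∑ K : {K : Finset (Fin n) // K.card = r},
      (-1 : ℝ) ^ (K.1.card * (K.1.card - 1) / 2) • (monomial η K.1 * monomial γ K.1) := by
  rw [pow_sum]
  have h1 : ∀ h : Fin r → Fin n, (List.ofFn fun p => η (h p) * γ (h p)).prod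
      = (-1 : ℝ) ^ (r * (r - 1) / 2) • ((List.ofFn fun p => η (h p)).prod
        * (List.ofFn fun p => γ (h p)).prod) := fun h =>
    prod_ofFn_mul_of_anticommute _ _ fun p q => hγη _ _
  simp only [h1]
  rw [sum_eq_sum_orderEmbOfFin_comp_perm _ fun h hh => by
    rw [prod_ofFn_eq_zero_of_not_injective hη h hh, zero_mul, smul_zero], Finset.smul_sum]
  refine Finset.sum_congr rfl fun K _ => ?_
  rw [K.2]
  simp only [Function.comp_apply]
  have h2 : ∀ σ : Equiv.Perm (Fin r),
      (-1 : ℝ) ^ (r * (r - 1) / 2) • ((List.ofFn fun p => η (K.1.orderEmbOfFin K.2 (σ p))).prod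
        * (List.ofFn fun p => γ (K.1.orderEmbOfFin K.2 (σ p))).prod)
      = (-1 : ℝ) ^ (r * (r - 1) / 2) • (monomial η K.1 * monomial γ K.1) := fun σ => by
    rw [prod_ofFn_comp_perm hη, prod_ofFn_comp_perm hγ, smul_mul_smul_comm, sign_mul_self_real,
      one_smul, prod_ofFn_orderEmbOfFin, prod_ofFn_orderEmbOfFin]
  simp only [h2, Finset.sum_const, Finset.card_univ, Fintype.card_perm, Fintype.card_fin,
    Nat.cast_smul_eq_nsmul]

theorem isEmpty_card_eq_succ : IsEmpty {K : Finset (Fin n) // K.card = n + 1} :=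
  ⟨fun K => by
    have := K.2 ▸ Finset.card_le_univ K.1
    simp at this⟩

theorem sum_mul_pow_succ (hη : ∀ i j, η i * η j = -(η j * η i))
    (hγ : ∀ i j, γ i * γ j = -(γ j * γ i)) (hγη : ∀ i j, γ i * η j = -(η j * γ i)) :
    (∑ j, η j * γ j) ^ (n + 1) = 0 := by
  have := isEmpty_card_eq_succ (n := n)
  rw [sum_mul_pow hη hγ hγη]
  simp

/-- The expansion of `exp (∑ η_j γ_j)` for anticommuting `η_j` and `γ_j`. -/
theorem nilExp_sum_mul (hη : ∀ i j, η i * η j = -(η j * η i))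
    (hγ : ∀ i j, γ i * γ j = -(γ j * γ i)) (hγη : ∀ i j, γ i * η j = -(η j * γ i)) :
    nilExp (∑ j, η j * γ j) = ∑ J : Finset (Fin n),
      (-1 : ℝ) ^ (J.card * (J.card - 1) / 2) • (monomial η J * monomial γ J) := by
  rw [nilExp_eq_sum (sum_mul_pow_succ hη hγ hγη), ← sum_range_sum_card]
  refine Finset.sum_congr rfl fun r _ => ?_
  rw [sum_mul_pow hη hγ hγη, smul_smul, inv_mul_cancel₀ (by positivity), one_smul]

/-- Functions from `Fin (2 q)` as sequences of pairs; the second entry of a pair comes first. -/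
def pairsEquiv (q : ℕ) (α : Type*) : (Fin q → α × α) ≃ (Fin (2 * q) → α) where
  toFun f p := if p.val % 2 = 0 then (f ⟨p.val / 2, by omega⟩).2 else (f ⟨p.val / 2, by omega⟩).1
  invFun h k := (h ⟨2 * k.val + 1, by omega⟩, h ⟨2 * k.val, by omega⟩)
  left_inv f := by
    funext k
    have h1 : (2 * k.val + 1) / 2 = k.val := by omega
    simp [h1, Nat.add_mod]
  right_inv h := by
    funext p
    by_cases hp : p.val % 2 = 0
    · simp only [hp, if_true]
      congr 1; ext; simp only; omega
    · simp only [hp, if_false]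
      congr 1; ext; simp only; omega

theorem prod_ofFn_pairs {R : Type*} [Ring R] {q : ℕ} (a : Fin (2 * q) → R) :
    (List.ofFn fun k : Fin q => a ⟨2 * k.val, by omega⟩ * a ⟨2 * k.val + 1, by omega⟩).prod
      = (List.ofFn a).prod := by
  rw [List.ofFn_mul', List.prod_flatten, List.map_ofFn]
  congr 2
  funext k
  simp [List.ofFn_succ]

theorem pfaff_subMatrix_of_card {K : Finset (Fin n)} (M : Matrix (Fin n) (Fin n) R) {q : ℕ}
    (hK : K.card = 2 * q) :
    pfaff (subMatrix M K) = ((2 ^ q * q.factorial : ℝ)⁻¹) • ∑ σ : Equiv.Perm (Fin (2 * q)),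
      ((Equiv.Perm.sign σ : ℤ) : R) * (List.ofFn fun k : Fin q =>
        M (K.orderEmbOfFin hK (σ ⟨2 * k.val + 1, by omega⟩))
          (K.orderEmbOfFin hK (σ ⟨2 * k.val, by omega⟩))).prod := by
  -- The cardinality is a variable here so that it can be substituted; `2 * q` cannot.
  have key : ∀ r (h : K.card = r), pfaff (subMatrix M K)
      = pfaff (M.submatrix (K.orderEmbOfFin h) (K.orderEmbOfFin h)) := by
    rintro r rfl; rfl
  rw [key _ hK, pfaff, if_pos (even_two_mul q)]
  have hq : 2 * q / 2 = q := by omega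
  congr 1
  · rw [hq]
  · refine Finset.sum_congr rfl fun σ _ => ?_
    congr 2
    exact List.ofFn_congr hq _

/-- The coefficients are central, so sorting the `η` yields the sign only once. The result is the
full sum over permutations in `pfaff`, up to its normalization `2^q q!`. -/
theorem quadratic_pow (hη : ∀ i j, η i * η j = -(η j * η i)) (M : Matrix (Fin n) (Fin n) R)
    (hM : ∀ i j x, Commute (M i j) x) (q : ℕ) :
    (∑ i, ∑ j, η j * M i j * η i) ^ q = (2 ^ q * q.factorial : ℝ) •
      ∑ K : {K : Finset (Fin n) // K.card = 2 * q},
        monomial η K.1 * pfaff (subMatrix M K.1) := by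
  have h0 : ∑ i, ∑ j, η j * M i j * η i = ∑ k : Fin n × Fin n, M k.1 k.2 * (η k.2 * η k.1) := by
    rw [Fintype.sum_prod_type]
    refine Finset.sum_congr rfl fun i _ => Finset.sum_congr rfl fun j _ => ?_
    rw [← (hM i j (η j)).eq, mul_assoc]
  rw [h0, pow_sum]
  -- In `η_j M_ij η_i` the column index is read first, so `j` sits at place `2k` and `i` at place
  -- `2k + 1`, matching the convention of `pfaff`.
  have h1 : ∀ f : Fin q → Fin n × Fin n,
      (List.ofFn fun k => M (f k).1 (f k).2 * (η (f k).2 * η (f k).1)).prod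
      = (fun h : Fin (2 * q) → Fin n => (List.ofFn fun p => η (h p)).prod
          * (List.ofFn fun k : Fin q => M (h ⟨2 * k.val + 1, by omega⟩)
            (h ⟨2 * k.val, by omega⟩)).prod) (pairsEquiv q (Fin n) f) := fun f => by
    obtain ⟨h, rfl⟩ := (pairsEquiv q (Fin n)).symm.surjective f
    simp only [Equiv.apply_symm_apply]
    rw [← prod_ofFn_pairs]
    rw [← prod_ofFn_mul_of_commute _ _ fun p q => hM _ _ _]
    congr 2
    funext k
    exact (hM _ _ _).eq
  simp only [h1]
  rw [(pairsEquiv q (Fin n)).sum_comp (fun h : Fin (2 * q) → Fin n =>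
      (List.ofFn fun p => η (h p)).prod * (List.ofFn fun k : Fin q =>
        M (h ⟨2 * k.val + 1, by omega⟩) (h ⟨2 * k.val, by omega⟩)).prod),
    sum_eq_sum_orderEmbOfFin_comp_perm _ fun h hh => by
      rw [prod_ofFn_eq_zero_of_not_injective hη h hh, zero_mul], Finset.smul_sum]
  refine Finset.sum_congr rfl fun K _ => ?_
  rw [pfaff_subMatrix_of_card M K.2, mul_smul_comm, smul_smul, mul_inv_cancel₀ (by positivity),
    one_smul, Finset.mul_sum]
  refine Finset.sum_congr rfl fun σ _ => ?_
  simp only [Function.comp_apply]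
  rw [prod_ofFn_comp_perm hη, prod_ofFn_orderEmbOfFin, smul_mul_assoc, Int.cast_smul_eq_zsmul,
    zsmul_eq_mul, ← mul_assoc, ← mul_assoc, (Int.cast_commute _ (monomial η K.1)).eq]

theorem pfaff_eq_zero_of_odd {r : ℕ} (M : Matrix (Fin r) (Fin r) R) (h : ¬ Even r) :
    pfaff M = 0 := if_neg h

theorem quadratic_pow_succ (hη : ∀ i j, η i * η j = -(η j * η i)) (M : Matrix (Fin n) (Fin n) R)
    (hM : ∀ i j x, Commute (M i j) x) :
    (∑ i, ∑ j, η j * M i j * η i) ^ (n + 1) = 0 := by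
  have : IsEmpty {K : Finset (Fin n) // K.card = 2 * (n + 1)} := ⟨fun K => by
    have := K.2 ▸ Finset.card_le_univ K.1
    simp at this
    omega⟩
  rw [quadratic_pow hη M hM]
  simp

/-- The expansion of `exp (c / 2 * ∑ M_{ij} η_j η_i)` for anticommuting `η_j` and central
`M_{ij}`. -/
theorem nilExp_quadratic (hη : ∀ i j, η i * η j = -(η j * η i)) (M : Matrix (Fin n) (Fin n) R)
    (hM : ∀ i j x, Commute (M i j) x) (c : ℝ) :
    nilExp ((c / 2) • ∑ i, ∑ j, η j * M i j * η i) = ∑ K : Finset (Fin n),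
      c ^ (K.card / 2) • (monomial η K * pfaff (subMatrix M K)) := by
  have hz : ((c / 2) • ∑ i, ∑ j, η j * M i j * η i) ^ (n + 1) = 0 := by
    rw [smul_pow, quadratic_pow_succ hη M hM, smul_zero]
  let f : Finset (Fin n) → R := fun K => c ^ (K.card / 2) • (monomial η K * pfaff (subMatrix M K))
  rw [nilExp_eq_sum hz]
  change _ = ∑ K, f K
  have h1 : ∀ q, ((q.factorial : ℝ)⁻¹) • ((c / 2) • ∑ i, ∑ j, η j * M i j * η i) ^ q
      = ∑ K : {K : Finset (Fin n) // K.card = 2 * q}, f K.1 := fun q => by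
    rw [smul_pow, quadratic_pow hη M hM, smul_smul, smul_smul, Finset.smul_sum]
    refine Finset.sum_congr rfl fun K _ => ?_
    simp only [f, K.2]
    congr 1
    rw [show 2 * q / 2 = q by omega]
    field_simp
    rw [← mul_pow]
    congr 1
    ring
  simp only [h1]
  -- The fibre of `K.card / 2` over `q` contains the cardinalities `2q` and `2q + 1`; the odd ones
  -- contribute zero.
  have h2 : ∀ K, f K ≠ 0 → K.card = 2 * (K.card / 2) := fun K hK => by
    by_contra h
    apply hK
    simp only [f]
    rw [pfaff_eq_zero_of_odd _ (by rw [Nat.even_iff]; omega), mul_zero, smul_zero]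
  rw [← Finset.sum_fiberwise_of_maps_to (s := Finset.univ) (t := Finset.range (n + 1))
    (g := fun K : Finset (Fin n) => K.card / 2)
    (by intro K _; have := Finset.card_le_univ K; simp at this ⊢; omega) f]
  refine Finset.sum_congr rfl fun q _ => ?_
  rw [← Finset.sum_subtype (Finset.univ.filter fun K : Finset (Fin n) => K.card = 2 * q)
    (fun K => by simp) f]
  refine Finset.sum_subset (fun K hK => by simp at hK ⊢; omega) fun K hK hK' => ?_
  by_contra h
  have := h2 K h
  simp at hK hK'
  omega

end Exponentials

/-! ### The superalgebra of functions -/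

section FunAlg

variable {V0 V1 : Type*} [AddCommGroup V0] [Module ℝ V0] [AddCommGroup V1] [Module ℝ V1]
  {P : Type*} [Ring P] [Algebra ℝ P] (𝒢 : ZMod 2 → Submodule ℝ P) [GradedAlgebra 𝒢]

variable (V1) in
/-- The algebra homomorphism `p ↦ 1 ⊗ p`. -/
def constHom : P →ₐ[ℝ] FunAlg V1 𝒢 := GradedTensorProduct.includeRight _ _

/-- The algebra homomorphism `w ↦ w ⊗ 1`. -/
def oddHom : ExteriorAlgebra ℝ (Module.Dual ℝ V1) →ₐ[ℝ] FunAlg V1 𝒢 :=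
  GradedTensorProduct.includeLeft _ _

theorem const_eq (p : P) : const 𝒢 V1 p = constHom V1 𝒢 p := rfl

theorem oddCoord_eq (η : Module.Dual ℝ V1) :
    oddCoord 𝒢 η = oddHom 𝒢 (ExteriorAlgebra.ι ℝ η) := rfl

theorem oddHom_mul_constHom (w : ExteriorAlgebra ℝ (Module.Dual ℝ V1)) (p : P) :
    oddHom 𝒢 w * constHom V1 𝒢 p = GradedTensorProduct.tmul ℝ w p :=
  GradedTensorProduct.tmul_one_mul_one_tmul _ _ w p

theorem oddCoord_mul_oddCoord (η η' : Module.Dual ℝ V1) :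
    oddCoord 𝒢 η * oddCoord 𝒢 η' = -(oddCoord 𝒢 η' * oddCoord 𝒢 η) := by
  have h := congrArg (oddHom 𝒢)
    (eq_neg_of_add_eq_zero_left (ExteriorAlgebra.ι_add_mul_swap (R := ℝ) η η'))
  rw [map_mul, map_neg, map_mul] at h
  exact h

variable {𝒢}

theorem constHom_mul_oddCoord_of_odd {p : P} (hp : p ∈ 𝒢 1) (η : Module.Dual ℝ V1) :
    constHom V1 𝒢 p * oddCoord 𝒢 η = -(oddCoord 𝒢 η * constHom V1 𝒢 p) := by
  have h := GradedTensorProduct.tmul_coe_mul_coe_tmul (R := ℝ)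
    (CliffordAlgebra.evenOdd (0 : QuadraticForm ℝ (Module.Dual ℝ V1))) 𝒢 (1 : ExteriorAlgebra ℝ _)
    (⟨p, hp⟩ : 𝒢 1) ⟨ExteriorAlgebra.ι ℝ η, CliffordAlgebra.ι_mem_evenOdd_one _ η⟩ (1 : P)
  rw [oddCoord_eq, oddHom_mul_constHom]
  refine h.trans ?_
  rw [one_mul, mul_one]
  simp

/-- The Koszul sign is trivial against every homogeneous element of the exterior algebra; against
the factor `P` the hypothesis `hc` applies. -/
theorem constHom_commute_of_even {p : P} (hp : p ∈ 𝒢 0) (hc : ∀ c, p * c = c * p)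
    (x : FunAlg V1 𝒢) : Commute (constHom V1 𝒢 p) x := by
  have h1 : ∀ w : ExteriorAlgebra ℝ (Module.Dual ℝ V1),
      Commute (constHom V1 𝒢 p) (oddHom 𝒢 w) := fun w => by
    refine DirectSum.Decomposition.inductionOn
      (CliffordAlgebra.evenOdd (0 : QuadraticForm ℝ (Module.Dual ℝ V1)))
      (motive := fun w => Commute (constHom V1 𝒢 p) (oddHom 𝒢 w)) ?_ ?_ ?_ w
    · rw [map_zero]; exact Commute.zero_right _
    · intro i a
      have h := GradedTensorProduct.tmul_zero_coe_mul_coe_tmul (R := ℝ)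
        (CliffordAlgebra.evenOdd (0 : QuadraticForm ℝ (Module.Dual ℝ V1))) 𝒢
        (1 : ExteriorAlgebra ℝ _) (⟨p, hp⟩ : 𝒢 0) a (1 : P)
      rw [Commute, SemiconjBy, oddHom_mul_constHom]
      refine h.trans ?_
      rw [one_mul, mul_one]
    · intro a c ha hc
      rw [map_add]
      exact ha.add_right hc
  obtain ⟨y, rfl⟩ := (GradedTensorProduct.of ℝ
    (CliffordAlgebra.evenOdd (0 : QuadraticForm ℝ (Module.Dual ℝ V1))) 𝒢).surjective x
  induction y with
  | zero => rw [map_zero]; exact Commute.zero_right _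
  | add a c ha hc => rw [map_add]; exact ha.add_right hc
  | tmul w c =>
    have : GradedTensorProduct.of ℝ
      (CliffordAlgebra.evenOdd (0 : QuadraticForm ℝ (Module.Dual ℝ V1))) 𝒢 (w ⊗ₜ c)
        = oddHom 𝒢 w * constHom V1 𝒢 c := (oddHom_mul_constHom 𝒢 w c).symm
    rw [this]
    refine (h1 w).mul_right ?_
    rw [Commute, SemiconjBy, ← map_mul, ← map_mul, hc]

theorem funBody_tmul (β : P →ₐ[ℝ] ℝ) (w : ExteriorAlgebra ℝ (Module.Dual ℝ V1)) (p : P) :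
    funBody 𝒢 β (oddHom 𝒢 w * constHom V1 𝒢 p) = ExteriorAlgebra.algebraMapInv w * β p := by
  rw [oddHom_mul_constHom]
  rfl

variable {F : SymplecticForm V0 V1} {m n : ℕ}

theorem berezin_tmul (b : SymplecticBasis F m n) (w : ExteriorAlgebra ℝ (Module.Dual ℝ V1))
    (p : P) : berezin b (oddHom 𝒢 w * constHom V1 𝒢 p)
      = ((-1 : ℝ) ^ (n * (n - 1) / 2)) • (b.topCoeff w ⊗ₜ[ℝ] p) := by
  rw [oddHom_mul_constHom]
  rfl

theorem topCoeff_ιMulti_of_ne (b : SymplecticBasis F m n) {r : ℕ} (hr : r ≠ n)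
    (v : Fin r → Module.Dual ℝ V1) : b.topCoeff (ExteriorAlgebra.ιMulti ℝ r v) = 0 := by
  rw [SymplecticBasis.topCoeff, LinearMap.comp_apply,
    ExteriorAlgebra.liftAlternating_apply_ιMulti, Pi.single_eq_of_ne hr]
  simp

theorem topCoeff_ιMulti (b : SymplecticBasis F m n) (v : Fin n → Module.Dual ℝ V1) :
    b.topCoeff (ExteriorAlgebra.ιMulti ℝ n v) = b.g.dualBasis.det v • ∏ j, b.s j := by
  rw [SymplecticBasis.topCoeff, LinearMap.comp_apply,
    ExteriorAlgebra.liftAlternating_apply_ιMulti, Pi.single_eq_same]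
  simp

theorem topCoeff_of_not_injective (b : SymplecticBasis F m n) {r : ℕ} (h : Fin r → Fin n)
    (hh : ¬ Function.Injective h) :
    b.topCoeff (ExteriorAlgebra.ιMulti ℝ r fun p => b.g.coord (h p)) = 0 := by
  rw [AlternatingMap.map_eq_zero_of_not_injective, map_zero]
  intro hi
  exact hh fun p q hpq => hi (by simp [hpq])

theorem topCoeff_perm (b : SymplecticBasis F m n) {r : ℕ} (hr : n = r) (h : Fin r → Fin n)
    (σ : Equiv.Perm (Fin n)) (hσ : ∀ p, σ p = h (Fin.cast hr p)) :
    b.topCoeff (ExteriorAlgebra.ιMulti ℝ r fun p => b.g.coord (h p))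
      = ((Equiv.Perm.sign σ : ℤ) : ℝ) • ∏ j, b.s j := by
  subst hr
  have : (fun p => b.g.coord (h p)) = (fun p => b.g.dualBasis p) ∘ σ := by
    funext p
    simp [hσ]
  rw [topCoeff_ιMulti, this, AlternatingMap.map_perm]
  congr 1
  rw [Module.Basis.det_self]
  simp [Units.smul_def]

theorem append_eq_sum_elim {α : Type*} {r q : ℕ} (a : Fin r → α) (c : Fin q → α)
    (p : Fin (r + q)) : Fin.append a c p = Sum.elim a c (finSumFinEquiv.symm p) := by
  refine Fin.addCases (fun i => ?_) (fun i => ?_) p <;> simp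

/-- Reads the shuffle as a concatenation of two increasing enumerations, which is the word of `ξ^J
ξ^{J'}`. -/
theorem shuffle_apply (J : Finset (Fin n)) (p : Fin n) :
    shuffle J p = Fin.append (J.orderEmbOfFin rfl) (Jᶜ.orderEmbOfFin rfl)
      (Fin.cast (by simp [Finset.card_add_card_compl]) p) := by
  rw [append_eq_sum_elim, shuffle]
  simp only [Equiv.trans_apply, finCongr_apply]
  generalize finSumFinEquiv.symm _ = q
  rcases q with q | q
  · simp
  · simp

theorem monomial_mul_monomial (b : SymplecticBasis F m n) (J K : Finset (Fin n)) :
    monomial (fun j => oddCoord 𝒢 (b.g.coord j)) J * monomial (fun j => oddCoord 𝒢 (b.g.coord j)) K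
      = oddHom 𝒢 (ExteriorAlgebra.ιMulti ℝ (J.card + K.card) fun p => b.g.coord
        (Fin.append (J.orderEmbOfFin rfl) (K.orderEmbOfFin rfl) p)) := by
  rw [ExteriorAlgebra.ιMulti_apply, map_list_prod, List.map_ofFn, monomial, monomial,
    ← List.prod_append, ← List.ofFn_fin_append]
  congr 2
  funext p
  refine Fin.addCases (fun i => ?_) (fun i => ?_) p <;> simp [oddCoord_eq]

/-- A word of length other than `n` has no top part. One of length `n` survives only without
repeated letters, which forces `K = Jᶜ`. -/
theorem topCoeff_append (b : SymplecticBasis F m n) (J K : Finset (Fin n)) :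
    b.topCoeff (ExteriorAlgebra.ιMulti ℝ (J.card + K.card) fun p => b.g.coord
        (Fin.append (J.orderEmbOfFin rfl) (K.orderEmbOfFin rfl) p))
      = if K = Jᶜ then eps J • ∏ j, b.s j else 0 := by
  split_ifs with hK
  · subst hK
    exact topCoeff_perm b (by simp [Finset.card_add_card_compl]) _ _ (shuffle_apply J)
  · by_cases hr : J.card + K.card = n
    · apply topCoeff_of_not_injective
      intro hi
      apply hK
      have hd : Disjoint K J := by
        rw [Finset.disjoint_left]
        intro a haK haJ
        have h1 : a ∈ Set.range (J.orderEmbOfFin rfl) := by simpa using haJ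
        have h2 : a ∈ Set.range (K.orderEmbOfFin rfl) := by simpa using haK
        obtain ⟨p, hp⟩ := h1
        obtain ⟨q, hq⟩ := h2
        have := @hi (Fin.castAdd _ p) (Fin.natAdd _ q) (by simp [hp, hq])
        have := congrArg Fin.val this
        simp at this
        omega
      apply Finset.eq_of_subset_of_card_le
      · exact Finset.subset_compl_iff_disjoint_right.mpr hd
      · rw [Finset.card_compl, Fintype.card_fin]; omega
    · exact topCoeff_ιMulti_of_ne b hr _

theorem berezin_monomial (b : SymplecticBasis F m n) (J K : Finset (Fin n)) (p : P) :
    berezin b (monomial (fun j => oddCoord 𝒢 (b.g.coord j)) J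
        * monomial (fun j => oddCoord 𝒢 (b.g.coord j)) K * constHom V1 𝒢 p)
      = if K = Jᶜ then ((-1 : ℝ) ^ (n * (n - 1) / 2) * eps J) • ((∏ j, b.s j) ⊗ₜ[ℝ] p) else 0 := by
  rw [monomial_mul_monomial, berezin_tmul, topCoeff_append]
  split_ifs
  · simp only [TensorProduct.smul_tmul', mul_smul]
  · simp

end FunAlg

/-! ### The entries of a point of `spo(V)` -/

section Entries

variable {V0 V1 : Type*} [AddCommGroup V0] [Module ℝ V0] [AddCommGroup V1] [Module ℝ V1]
  {P : Type*} [Ring P] [Algebra ℝ P] {𝒢 : ZMod 2 → Submodule ℝ P}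
  {F : SymplecticForm V0 V1} {m n : ℕ}

theorem contract_mem {M : Type*} [AddCommGroup M] [Module ℝ M] (S : Submodule ℝ P)
    (φ : M →ₗ[ℝ] ℝ) (t : M ⊗[ℝ] S) : contract S φ t ∈ S := by
  induction t with
  | zero => simp
  | add a c ha hc => rw [map_add]; exact S.add_mem ha hc
  | tmul x p => simpa [contract] using S.smul_mem _ p.2

theorem contract_add {M : Type*} [AddCommGroup M] [Module ℝ M] (S : Submodule ℝ P)
    (φ ψ : M →ₗ[ℝ] ℝ) (t : M ⊗[ℝ] S) :
    contract S (φ + ψ) t = contract S φ t + contract S ψ t := by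
  simp [contract, TensorProduct.map_add_left]

theorem contract_smul {M : Type*} [AddCommGroup M] [Module ℝ M] (S : Submodule ℝ P)
    (c : ℝ) (φ : M →ₗ[ℝ] ℝ) (t : M ⊗[ℝ] S) :
    contract S (c • φ) t = c • contract S φ t := by
  simp [contract, TensorProduct.map_smul_left]

theorem contract_sum {M ι : Type*} [AddCommGroup M] [Module ℝ M] (S : Submodule ℝ P)
    (s : Finset ι) (φ : ι → M →ₗ[ℝ] ℝ) (t : M ⊗[ℝ] S) :
    contract S (∑ i ∈ s, φ i) t = ∑ i ∈ s, contract S (φ i) t := by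
  classical
  induction s using Finset.induction_on with
  | empty => simp [contract]
  | insert a s ha ih => rw [Finset.sum_insert ha, Finset.sum_insert ha, contract_add, ih]

theorem formA_sum_smul {ι : Type*} (s : Finset ι) (A : sp F ⊗[ℝ] 𝒢 0) (x : ι → ℝ) (v : ι → V0) :
    formA A (∑ i ∈ s, x i • v i) (∑ i ∈ s, x i • v i)
      = ∑ i ∈ s, ∑ j ∈ s, (x i * x j) • formA A (v i) (v j) := by
  simp only [formA]
  simp only [← contract_smul, ← contract_sum]
  congr 2
  ext T
  simp only [map_sum, map_smul, LinearMap.comp_apply, LinearMap.sum_apply, LinearMap.smul_apply,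
    LinearMap.applyₗ_apply_apply, smul_eq_mul, Finset.mul_sum]
  rw [Finset.sum_comm]
  exact Finset.sum_congr rfl fun i _ => Finset.sum_congr rfl fun j _ => by ring

theorem formC_sum_smul {ι : Type*} (s : Finset ι) (BC : spoOdd F ⊗[ℝ] 𝒢 1) (w : V1) (x : ι → ℝ)
    (v : ι → V0) : formC BC w (∑ i ∈ s, x i • v i) = ∑ i ∈ s, x i • formC BC w (v i) := by
  simp only [formC]
  simp only [← contract_smul, ← contract_sum]
  congr 2
  ext T
  simp

/-- This is the defining relation of `spoOdd`, read through the symmetry of `F.B1`. -/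
theorem formB_eq_neg_formC (BC : spoOdd F ⊗[ℝ] 𝒢 1) (v : V0) (w : V1) :
    formB BC v w = -formC BC w v := by
  rw [← neg_one_smul ℝ (formC BC w v), formB, formC, ← contract_smul]
  congr 2
  ext T
  have := T.2 v w
  have h2 := F.symm.eq w (T.1.2 v)
  simp at this h2 ⊢
  linarith

/-- The `g_j` are orthogonal and `s_j² B(g_j, g_j) = 1`, so dividing by `B(g_j, g_j)` is multiplying
by `s_j²`. -/
theorem coord_eq (b : SymplecticBasis F m n) (j : Fin n) (w : V1) :
    (b.g.coord j w : ℂ) = b.s j * b.s j * (F.B1 (b.g j) w : ℂ) := by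
  conv_rhs => rw [← b.g.sum_repr w]
  simp only [map_sum, map_smul, smul_eq_mul, Complex.ofReal_sum, Complex.ofReal_mul,
    Finset.mul_sum]
  rw [Finset.sum_eq_single j]
  · have := b.f_orthonormal j j
    rw [if_pos rfl] at this
    rw [mul_left_comm, this, mul_one]
    rfl
  · intro k _ hk
    have := b.f_orthonormal j k
    rw [if_neg hk.symm] at this
    have hs : b.s k ≠ 0 := by rcases b.s_eq k with h | h <;> simp [h]
    have hs' : b.s j ≠ 0 := by rcases b.s_eq j with h | h <;> simp [h]
    have : (F.B1 (b.g j) (b.g k) : ℂ) = 0 := by simpa [hs, hs'] using this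
    rw [this]; ring
  · simp

theorem s_ne_zero (b : SymplecticBasis F m n) (j : Fin n) : b.s j ≠ 0 := by
  rcases b.s_eq j with h | h <;> simp [h]

/-- Since `s_j² = ±1` is real, it crosses the tensor product over `ℝ` and turns `s_j⁻¹` into `s_j`.
Entries in the basis `f` thereby become values of the form on the `g_j`, scaled by phases. -/
theorem contract_coord (b : SymplecticBasis F m n) {M : Type*} [AddCommGroup M] [Module ℝ M]
    (S : Submodule ℝ P) (j : Fin n) (f : M →ₗ[ℝ] V1) (c : ℂ) (t : M ⊗[ℝ] S) :
    ((b.s j)⁻¹ * c) ⊗ₜ[ℝ] contract S ((b.g.coord j).comp f) t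
      = (b.s j * c) ⊗ₜ[ℝ] contract S ((F.B1 (b.g j)).comp f) t := by
  obtain ⟨ε, hε⟩ : ∃ ε : ℝ, (ε : ℂ) = b.s j * b.s j := by
    rcases b.s_eq j with h | h
    · exact ⟨1, by simp [h]⟩
    · exact ⟨-1, by simp [h]⟩
  have h1 : (b.g.coord j).comp f = ε • (F.B1 (b.g j)).comp f := by
    ext x
    have := coord_eq b j (f x)
    rw [← hε] at this
    exact_mod_cast this
  rw [h1, contract_smul, ← TensorProduct.smul_tmul, Complex.real_smul, hε]
  congr 1
  field_simp [s_ne_zero b j]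

theorem matD_eq (b : SymplecticBasis F m n) (D : so F ⊗[ℝ] 𝒢 0) (j k : Fin n) :
    matD b D j k = (b.s j * b.s k) ⊗ₜ[ℝ] formD D (b.g j) (b.g k) :=
  contract_coord b (𝒢 0) j _ _ D

theorem matC_eq (b : SymplecticBasis F m n) (BC : spoOdd F ⊗[ℝ] 𝒢 1) (j : Fin n) (i : Fin m) :
    matC b BC j i = b.s j ⊗ₜ[ℝ] formC BC (b.g j) (b.e i) := by
  have := contract_coord b (𝒢 1) j ((LinearMap.applyₗ (b.e i)).comp
      ((LinearMap.snd ℝ (V1 →ₗ[ℝ] V0) (V0 →ₗ[ℝ] V1)).comp (spoOdd F).subtype)) 1 BC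
  rw [mul_one, mul_one] at this
  exact this

theorem body_formA (β : P →ₐ[ℝ] ℝ) (A : sp F ⊗[ℝ] 𝒢 0) (v w : V0) :
    β (formA A v w) = F.B0 v ((bodyA β A : V0 →ₗ[ℝ] V0) w) := by
  induction A with
  | zero => simp [formA, bodyA]
  | add a c ha hc =>
    simp only [formA, bodyA, map_add] at ha hc ⊢
    rw [ha, hc]
    simp
  | tmul x p =>
    simp [formA, bodyA, contract, mul_comm]

end Entries

/-! ### Tensoring matrix expressions with complex numbers -/

section Scaling

variable {P : Type*} [Ring P] [Algebra ℝ P]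

theorem prod_ofFn_tmul {r : ℕ} (s : Fin r → ℂ) (a : Fin r → P) :
    (List.ofFn fun k => s k ⊗ₜ[ℝ] a k).prod = (∏ k, s k) ⊗ₜ[ℝ] (List.ofFn a).prod := by
  induction r with
  | zero => simp [Algebra.TensorProduct.one_def]
  | succ r ih => simp [List.ofFn_succ, Fin.prod_univ_succ, ih]

theorem phi_tmul {r : ℕ} (s : Fin r → ℂ) (M : Matrix (Fin r) (Fin r) P) :
    phi (Matrix.of fun k l => s k ⊗ₜ[ℝ] M k l) = (∏ k, s k) ⊗ₜ[ℝ] phi M := by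
  simp only [phi, Matrix.of_apply, TensorProduct.tmul_sum]
  exact Finset.sum_congr rfl fun σ _ => prod_ofFn_tmul _ _

theorem prod_pairs {q : ℕ} (s : Fin (2 * q) → ℂ) :
    ∏ k : Fin q, (s ⟨2 * k.val + 1, by omega⟩ * s ⟨2 * k.val, by omega⟩) = ∏ p, s p := by
  rw [← List.prod_ofFn (f := s), ← prod_ofFn_pairs, List.prod_ofFn]
  exact Finset.prod_congr rfl fun k _ => mul_comm _ _

/-- Every index occurs exactly once in each term of the Pfaffian, so each term carries the same
product of phases. -/
theorem pfaff_tmul {r : ℕ} (s : Fin r → ℂ) (M : Matrix (Fin r) (Fin r) P) :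
    pfaff (Matrix.of fun k l => (s k * s l) ⊗ₜ[ℝ] M k l) = (∏ k, s k) ⊗ₜ[ℝ] pfaff M := by
  by_cases hr : Even r
  · obtain ⟨q, hq⟩ := hr
    have hr : r = 2 * (r / 2) := by omega
    rw [pfaff, pfaff, if_pos ⟨q, hq⟩, if_pos ⟨q, hq⟩, TensorProduct.tmul_smul,
      TensorProduct.tmul_sum]
    congr 1
    refine Finset.sum_congr rfl fun σ _ => ?_
    simp only [Matrix.of_apply]
    rw [prod_ofFn_tmul]
    have h1 : ∏ k : Fin (r / 2), (s (σ ⟨2 * k.val + 1, by omega⟩) * s (σ ⟨2 * k.val, by omega⟩))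
        = ∏ p, s p := by
      rw [← Equiv.prod_comp σ, ← Equiv.prod_comp (finCongr hr.symm)]
      exact prod_pairs fun p => s (σ (finCongr hr.symm p))
    rw [h1, ← zsmul_eq_mul, ← zsmul_eq_mul, TensorProduct.tmul_smul]
  · rw [pfaff, pfaff, if_neg hr, if_neg hr, TensorProduct.tmul_zero]

theorem map_pfaff {R R' : Type*} [Ring R] [Algebra ℝ R] [Ring R'] [Algebra ℝ R'] (f : R →ₐ[ℝ] R')
    {r : ℕ} (M : Matrix (Fin r) (Fin r) R) : f (pfaff M) = pfaff (M.map f) := by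
  rw [pfaff, pfaff]
  split_ifs
  · simp only [map_smul, map_sum, map_mul, map_intCast, map_list_prod, List.map_ofFn]
    rfl
  · exact map_zero f

theorem prod_orderEmbOfFin (s : Fin n → ℂ) (J : Finset (Fin n)) :
    ∏ p, s (J.orderEmbOfFin rfl p) = ∏ j ∈ J, s j := by
  rw [← Finset.prod_coe_sort J s, ← Equiv.prod_comp (J.orderIsoOfFin rfl).toEquiv]
  rfl

end Scaling

/-! ### Integrals with values in finite dimensional spaces -/

section WeakIntegral

open MeasureTheory

variable {m : ℕ} {E E' : Type*} [AddCommGroup E] [Module ℝ E] [AddCommGroup E'] [Module ℝ E']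

theorem WeaklyIntegrable.map {f : (Fin m → ℝ) → E} (hf : WeaklyIntegrable f) (L : E →ₗ[ℝ] E') :
    WeaklyIntegrable fun x => L (f x) := fun φ => hf (φ.comp L)

theorem WeaklyIntegrable.sum {ι : Type*} {s : Finset ι} {f : ι → (Fin m → ℝ) → E}
    (hf : ∀ i ∈ s, WeaklyIntegrable (f i)) : WeaklyIntegrable fun x => ∑ i ∈ s, f i x := fun φ => by
  simp only [map_sum]
  exact integrable_finsetSum _ fun i hi => hf i hi φ

variable [FiniteDimensional ℝ E] [FiniteDimensional ℝ E']

/-- Characterizes `weakIntegral` by linear forms, freeing it from the chosen basis; linearity and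
change of variables reduce to scalar integrals. -/
theorem apply_weakIntegral {f : (Fin m → ℝ) → E} (hf : WeaklyIntegrable f)
    (φ : Module.Dual ℝ E) : φ (weakIntegral f) = ∫ x, φ (f x) := by
  have h : ∀ x, φ (f x) = ∑ k, (Module.finBasis ℝ E).repr (f x) k * φ (Module.finBasis ℝ E k) :=
    fun x => by
      conv_lhs => rw [← (Module.finBasis ℝ E).sum_repr (f x)]
      simp only [map_sum, map_smul, smul_eq_mul]
  have hi : ∀ k ∈ Finset.univ, Integrable fun x =>
      (Module.finBasis ℝ E).repr (f x) k * φ (Module.finBasis ℝ E k) := fun k _ =>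
    (hf ((Module.finBasis ℝ E).coord k)).mul_const _
  simp only [h]
  rw [integral_finsetSum _ hi]
  simp only [integral_mul_const, weakIntegral, map_sum, map_smul, smul_eq_mul]

theorem weakIntegral_eq_of_forall {f : (Fin m → ℝ) → E} (hf : WeaklyIntegrable f) (y : E)
    (h : ∀ φ : Module.Dual ℝ E, ∫ x, φ (f x) = φ y) : weakIntegral f = y := by
  apply (Module.finBasis ℝ E).ext_elem
  intro k
  exact (apply_weakIntegral hf ((Module.finBasis ℝ E).coord k)).trans (h _)

theorem weakIntegral_map {f : (Fin m → ℝ) → E} (hf : WeaklyIntegrable f) (L : E →ₗ[ℝ] E') :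
    weakIntegral (fun x => L (f x)) = L (weakIntegral f) :=
  weakIntegral_eq_of_forall (hf.map L) _ fun φ => (apply_weakIntegral hf (φ.comp L)).symm

theorem weakIntegral_sum {ι : Type*} {s : Finset ι} {f : ι → (Fin m → ℝ) → E}
    (hf : ∀ i ∈ s, WeaklyIntegrable (f i)) :
    weakIntegral (fun x => ∑ i ∈ s, f i x) = ∑ i ∈ s, weakIntegral (f i) :=
  weakIntegral_eq_of_forall (WeaklyIntegrable.sum hf) _ fun φ => by
    simp only [map_sum]
    rw [integral_finsetSum _ fun i hi => hf i hi φ]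
    exact Finset.sum_congr rfl fun i hi => (apply_weakIntegral (hf i hi) φ).symm

theorem measurePreserving_of_abs_det {T : (Fin m → ℝ) →ₗ[ℝ] (Fin m → ℝ)}
    (hT : |LinearMap.det T| = 1) : MeasurePreserving T := by
  have h0 : LinearMap.det T ≠ 0 := fun h => by simp [h] at hT
  refine ⟨(LinearMap.continuous_of_finiteDimensional T).measurable, ?_⟩
  rw [Real.map_linearMap_volume_pi_eq_smul_volume_pi h0, abs_inv, hT]
  simp

theorem measurableEmbedding_of_abs_det {T : (Fin m → ℝ) →ₗ[ℝ] (Fin m → ℝ)}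
    (hT : |LinearMap.det T| = 1) : MeasurableEmbedding T := by
  have h0 : LinearMap.det T ≠ 0 := fun h => by simp [h] at hT
  exact (T.equivOfDetNeZero h0).toContinuousLinearEquiv.toHomeomorph.measurableEmbedding

theorem weaklyIntegrable_comp_linearMap {E : Type*} [AddCommGroup E] [Module ℝ E]
    {f : (Fin m → ℝ) → E} (hf : WeaklyIntegrable f)
    {T : (Fin m → ℝ) →ₗ[ℝ] (Fin m → ℝ)} (hT : |LinearMap.det T| = 1) :
    WeaklyIntegrable fun x => f (T x) := fun φ =>
  (measurePreserving_of_abs_det hT).integrable_comp_of_integrable (hf φ)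

theorem weakIntegral_comp_linearMap {f : (Fin m → ℝ) → E} (hf : WeaklyIntegrable f)
    {T : (Fin m → ℝ) →ₗ[ℝ] (Fin m → ℝ)} (hT : |LinearMap.det T| = 1) :
    weakIntegral (fun x => f (T x)) = weakIntegral f :=
  weakIntegral_eq_of_forall (weaklyIntegrable_comp_linearMap hf hT) _ fun φ => by
    rw [apply_weakIntegral hf]
    exact (measurePreserving_of_abs_det hT).integral_comp (measurableEmbedding_of_abs_det hT)
      fun x => φ (f x)

end WeakIntegral

/-! ### Gaussian moments -/

section Gaussian

open MeasureTheory

variable {m : ℕ}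

/-- The form attains a positive minimum on the compact unit sphere, and homogeneity spreads the
bound to all vectors. -/
theorem exists_sq_le_quadratic (q : Fin m → Fin m → ℝ)
    (hq : ∀ x : Fin m → ℝ, x ≠ 0 → 0 < ∑ i, ∑ j, x i * x j * q i j) :
    ∃ c > 0, ∀ x : Fin m → ℝ, c * ∑ i, x i ^ 2 ≤ ∑ i, ∑ j, x i * x j * q i j := by
  -- For `m = 0` the unit sphere is empty.
  rcases Nat.eq_zero_or_pos m with rfl | hm
  · exact ⟨1, one_pos, fun x => by simp⟩
  have : Nonempty (Fin m) := ⟨⟨0, hm⟩⟩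
  have hne : (Metric.sphere (0 : Fin m → ℝ) 1).Nonempty :=
    NormedSpace.sphere_nonempty.mpr zero_le_one
  obtain ⟨y, hy, hmin⟩ := (isCompact_sphere (0 : Fin m → ℝ) 1).exists_isMinOn hne
    (f := fun x => ∑ i, ∑ j, x i * x j * q i j) (by fun_prop)
  have hy0 : y ≠ 0 := fun h => by simp [h] at hy
  set c := ∑ i, ∑ j, y i * y j * q i j with hc
  have hcpos : 0 < c := hq y hy0
  have hm' : (0 : ℝ) < m := by exact_mod_cast hm
  -- The norm is the sup norm, and `∑ x_i² ≤ m ‖x‖²`; hence the division by `m`.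
  refine ⟨c / m, div_pos hcpos hm', fun x => ?_⟩
  have h1 : c * ‖x‖ ^ 2 ≤ ∑ i, ∑ j, x i * x j * q i j := by
    by_cases hx : x = 0
    · simp [hx]
    have hx' : ‖x‖ ≠ 0 := norm_ne_zero_iff.mpr hx
    have hs : ‖x‖⁻¹ • x ∈ Metric.sphere (0 : Fin m → ℝ) 1 := by
      simp [norm_smul, hx']
    have h2 := hmin hs
    simp only [Set.mem_ofPred_eq, Pi.smul_apply, smul_eq_mul] at h2
    have h3 : ∑ i, ∑ j, ‖x‖⁻¹ * x i * (‖x‖⁻¹ * x j) * q i j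
        = (‖x‖⁻¹) ^ 2 * ∑ i, ∑ j, x i * x j * q i j := by
      simp only [Finset.mul_sum]
      exact Finset.sum_congr rfl fun i _ => Finset.sum_congr rfl fun j _ => by ring
    rw [h3, ← hc, inv_pow, inv_mul_eq_div, le_div_iff₀ (by positivity)] at h2
    exact h2
  have h4 : ∑ i, x i ^ 2 ≤ m * ‖x‖ ^ 2 := by
    calc ∑ i, x i ^ 2 ≤ ∑ _i : Fin m, ‖x‖ ^ 2 := Finset.sum_le_sum fun i _ => by
          rw [← sq_abs]
          exact pow_le_pow_left₀ (abs_nonneg _) (norm_le_pi_norm x i) 2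
      _ = m * ‖x‖ ^ 2 := by simp
  calc c / m * ∑ i, x i ^ 2 ≤ c / m * (m * ‖x‖ ^ 2) := by gcongr
    _ = c * ‖x‖ ^ 2 := by field_simp
    _ ≤ _ := h1

theorem integrable_pow_mul_exp_neg_mul_sq {c : ℝ} (hc : 0 < c) (k : ℕ) :
    Integrable fun x : ℝ => x ^ k * Real.exp (-c * x ^ 2) := by
  have := integrable_rpow_mul_exp_neg_mul_sq hc (s := k)
    (lt_of_lt_of_le neg_one_lt_zero (Nat.cast_nonneg k))
  simpa only [Real.rpow_natCast] using this

/-- Positive definiteness dominates each monomial term by a product of one-variable Gaussian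
moments. -/
theorem integrable_eval_mul_exp_quadratic (q : Fin m → Fin m → ℝ)
    (hq : ∀ x : Fin m → ℝ, x ≠ 0 → 0 < ∑ i, ∑ j, x i * x j * q i j)
    (p : MvPolynomial (Fin m) ℝ) : Integrable fun x : Fin m → ℝ =>
      MvPolynomial.eval x p * Real.exp (-(1 / 2) * ∑ i, ∑ j, x i * x j * q i j) := by
  obtain ⟨c, hc, hle⟩ := exists_sq_le_quadratic q hq
  induction p using MvPolynomial.induction_on' with
  | add p p' hp hp' =>
    simp only [map_add, add_mul]
    exact hp.add hp'
  | monomial I a =>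
    have he : ∀ x : Fin m → ℝ, MvPolynomial.eval x (MvPolynomial.monomial I a)
        = a * ∏ i, x i ^ I i := fun x => by
      rw [MvPolynomial.eval_monomial, Finsupp.prod_fintype _ _ fun _ => pow_zero _]
    simp only [he]
    have h1 : Integrable fun x : Fin m → ℝ =>
        a * ∏ i, (x i ^ I i * Real.exp (-(c / 2) * x i ^ 2)) :=
      (Integrable.fintype_prod (μ := fun _ => volume) fun i =>
        integrable_pow_mul_exp_neg_mul_sq (half_pos hc) (I i)).const_mul a
    refine h1.mono (by fun_prop) (Filter.Eventually.of_forall fun x => ?_)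
    have h2 : ∏ i, Real.exp (-(c / 2) * x i ^ 2) = Real.exp (-(c / 2) * ∑ i, x i ^ 2) := by
      rw [← Real.exp_sum, Finset.mul_sum]
    rw [Finset.prod_mul_distrib, h2, ← mul_assoc, norm_mul, norm_mul _ (Real.exp _), Real.norm_eq_abs
      (Real.exp _), Real.norm_eq_abs (Real.exp _), Real.abs_exp, Real.abs_exp]
    refine mul_le_mul_of_nonneg_left (Real.exp_le_exp.mpr ?_) (norm_nonneg _)
    have := hle x
    linarith

end Gaussian

/-! ### Near superalgebras -/

section Near

variable {P : Type*} [Ring P] [Algebra ℝ P] [FiniteDimensional ℝ P]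

/-- In a finite dimensional local algebra the kernel of the body map is nil, of bounded index. -/
theorem exists_pow_eq_zero_of_isLocalRing [IsLocalRing P] (β : P →ₐ[ℝ] ℝ) :
    ∃ N : ℕ, ∀ a : P, β a = 0 → a ^ N = 0 := by
  have : IsArtinianRing P := IsArtinianRing.of_finite ℝ P
  obtain ⟨N, hN⟩ := IsArtinianRing.isNilpotent_jacobson_bot (R := P)
  refine ⟨N, fun a ha => ?_⟩
  have hmem : a ∈ (⊥ : Ideal P).jacobson := by
    rw [Ideal.mem_jacobson_iff]
    intro y
    -- The body of `y * a` is zero, so `-(y * a)` is not a unit and locality leaves `1 + y * a`.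
    -- Thus `a` lies in the Jacobson radical, nilpotent in an Artinian ring.
    have hu : IsUnit (1 + y * a) := by
      rcases IsLocalRing.isUnit_or_isUnit_of_add_one (a := 1 + y * a) (b := -(y * a)) (by abel)
        with h | h
      · exact h
      · have := h.map β
        simp [ha] at this
    obtain ⟨u, hu⟩ := hu
    refine ⟨(u⁻¹ : Pˣ), ?_⟩
    have : (u⁻¹ : Pˣ) * (1 + y * a) = 1 := by rw [← hu]; simp
    rw [mul_add, mul_one, ← mul_assoc] at this
    rw [Submodule.mem_bot, ← this]
    abel
  have := Ideal.pow_mem_pow hmem N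
  rw [hN] at this
  simpa using this

variable {V0 V1 : Type*} [AddCommGroup V0] [Module ℝ V0] [AddCommGroup V1] [Module ℝ V1]
  {F : SymplecticForm V0 V1} {m n : ℕ} {𝒢 : ZMod 2 → Submodule ℝ P}

/-- The body contributes a scalar Gaussian. The soul is quadratic in `x` and nilpotent of index
bounded uniformly in `x`, so its exponential is a polynomial with coefficients in `P`. -/
theorem weaklyIntegrable_momentIntegrand [IsLocalRing P] (b : SymplecticBasis F m n)
    (β : P →ₐ[ℝ] ℝ) (A : sp F ⊗[ℝ] 𝒢 0)
    (hA : ∀ v : V0, v ≠ 0 → 0 < F.B0 v ((bodyA β A : V0 →ₗ[ℝ] V0) v)) (I : Fin m → ℕ) :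
    WeaklyIntegrable (momentIntegrand b β A I) := by
  intro φ
  obtain ⟨N, hN⟩ := exists_pow_eq_zero_of_isLocalRing β
  let a : Fin m → Fin m → P := fun i j => formA A (b.e i) (b.e j)
  let q : Fin m → Fin m → ℝ := fun i j => β (a i j)
  let s : Fin m × Fin m → P := fun k => (-(1 / 2) : ℝ) • (a k.1 k.2 - algebraMap ℝ P (q k.1 k.2))
  have ha : ∀ x : Fin m → ℝ, formA A (b.point x) (b.point x)
      = ∑ i, ∑ j, (x i * x j) • a i j := fun x => formA_sum_smul _ A x _
  have hβ : ∀ x : Fin m → ℝ, β (formA A (b.point x) (b.point x))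
      = ∑ i, ∑ j, x i * x j * q i j := fun x => by simp [ha, q]
  have hq : ∀ x : Fin m → ℝ, x ≠ 0 → 0 < ∑ i, ∑ j, x i * x j * q i j := fun x hx => by
    rw [← hβ, body_formA]
    apply hA
    intro h0
    apply hx
    funext i
    exact Fintype.linearIndependent_iff.mp b.e.linearIndependent x h0 i
  -- This is `x^I` times `φ` of the truncated exponential series of the soul, expanded over words in
  -- the coefficients `s`.
  let p : MvPolynomial (Fin m) ℝ := (∏ i, MvPolynomial.X i ^ I i) *
    ∑ k ∈ Finset.range N, ∑ h : Fin k → Fin m × Fin m,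
      MvPolynomial.C ((k.factorial : ℝ)⁻¹ * φ (List.ofFn fun l => s (h l)).prod) *
        ∏ l, (MvPolynomial.X (h l).1 * MvPolynomial.X (h l).2)
  refine (integrable_eval_mul_exp_quadratic q hq p).congr (Filter.Eventually.of_forall fun x => ?_)
  have hsoul : (-(1 / 2) : ℝ) • formA A (b.point x) (b.point x) - algebraMap ℝ P
      (β.toLinearMap ((-(1 / 2) : ℝ) • formA A (b.point x) (b.point x)))
      = ∑ k : Fin m × Fin m, (x k.1 * x k.2) • s k := by
    rw [AlgHom.toLinearMap_apply, map_smul, hβ, ha, Fintype.sum_prod_type]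
    simp only [s, smul_eq_mul, map_mul, map_sum, Algebra.algebraMap_eq_smul_one, Finset.smul_sum,
      Finset.mul_sum, ← Finset.sum_sub_distrib, smul_sub, smul_smul,
      smul_mul_smul_comm, mul_one]
    refine Finset.sum_congr rfl fun i _ => Finset.sum_congr rfl fun j _ => ?_
    congr 2 <;> ring
  have hs : ∀ k, ((-(1 / 2) : ℝ) • formA A (b.point x) (b.point x) - algebraMap ℝ P
      (β.toLinearMap ((-(1 / 2) : ℝ) • formA A (b.point x) (b.point x)))) ^ k
      = ∑ h : Fin k → Fin m × Fin m, (∏ l, (x (h l).1 * x (h l).2)) •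
        (List.ofFn fun l => s (h l)).prod := fun k => by
    rw [hsoul, pow_sum]
    exact Finset.sum_congr rfl fun h _ => prod_ofFn_smul _ _
  simp only [momentIntegrand]
  have hb : β.toLinearMap ((-(1 / 2) : ℝ) • formA A (b.point x) (b.point x))
      = -(1 / 2) * ∑ i, ∑ j, x i * x j * q i j := by
    rw [AlgHom.toLinearMap_apply, map_smul, hβ, smul_eq_mul]
  have hE : superExp β.toLinearMap ((-(1 / 2) : ℝ) • formA A (b.point x) (b.point x))
      = Real.exp (-(1 / 2) * ∑ i, ∑ j, x i * x j * q i j) • ∑ k ∈ Finset.range N,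
        ((k.factorial : ℝ)⁻¹) • ∑ h : Fin k → Fin m × Fin m, (∏ l, (x (h l).1 * x (h l).2)) •
          (List.ofFn fun l => s (h l)).prod := by
    rw [superExp_eq, nilExp_eq_sum (hN _ (by simp))]
    exact congrArg₂ (· • ·) (by rw [hb]) (Finset.sum_congr rfl fun k _ => by rw [hs k])
  rw [hE]
  generalize Real.exp _ = ex
  simp only [map_smul, map_sum, smul_eq_mul, p, map_mul,
    map_prod, map_pow, MvPolynomial.eval_X, MvPolynomial.eval_C, Finset.mul_sum, Finset.sum_mul]
  refine Finset.sum_congr rfl fun k _ => Finset.sum_congr rfl fun h _ => ?_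
  ring

end Near

/-! ### Expansions of the ingredients of the integrand -/

section Expansions

variable {R : Type*} [Ring R] [Algebra ℝ R] {m n : ℕ}

theorem neg_one_pow_mul_self (k : ℕ) : (-1 : ℝ) ^ k * (-1 : ℝ) ^ k = 1 := by
  rw [← mul_pow]; simp

/-- Expanding chooses a column for each row of `J`; the power of `x` depends only on the
multiplicities `I`. Summing over permutations of a representative counts each choice `I!` times. The
sign in front undoes the one built into `coeffC`. -/
theorem monomial_sum_smul (C : Matrix (Fin n) (Fin m) R) (x : Fin m → ℝ) (J : Finset (Fin n)) :
    monomial (fun j => ∑ i, x i • C j i) J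
      = ∑ I ∈ Finset.piAntidiag (Finset.univ : Finset (Fin m)) J.card,
        ((-1 : ℝ) ^ (J.card * (J.card - 1) / 2) * ∏ i, x i ^ I i) • coeffC C I J := by
  rw [monomial, prod_ofFn_sum]
  simp only [prod_ofFn_smul]
  -- The branch `0` only makes the cast expressible; it is never reached on `piAntidiag`.
  rw [sum_eq_sum_piAntidiag _ fun I => if h : ∑ k, I k = J.card then
    (∏ i, x i ^ I i) • phi ((repMatrix C J I).submatrix id (Fin.cast h.symm)) else 0]
  · refine Finset.sum_congr rfl fun I hI => ?_
    have h : ∑ k, I k = J.card := by simpa using hI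
    rw [dif_pos h, coeffC, dif_pos h, smul_smul, smul_smul]
    congr 1
    rw [mul_mul_mul_comm, neg_one_pow_mul_self]
    ring
  · intro I h
    refine ⟨_, fiberCard_repeats I h, ?_⟩
    rw [dif_pos h, phi, Finset.smul_sum]
    refine Finset.sum_congr rfl fun σ _ => ?_
    rw [prod_comp_eq_prod_pow_fiberCard, fiberCard_comp_perm, fiberCard_repeats I h]
    rfl

theorem map_monomial {R' : Type*} [Ring R'] [Algebra ℝ R'] (f : R →ₐ[ℝ] R') (θ : Fin n → R)
    (J : Finset (Fin n)) : f (monomial θ J) = monomial (fun j => f (θ j)) J := by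
  rw [monomial, map_list_prod, List.map_ofFn]
  rfl

theorem map_pfaff_subMatrix {R' : Type*} [Ring R'] [Algebra ℝ R'] (f : R →ₐ[ℝ] R')
    (M : Matrix (Fin n) (Fin n) R) (J : Finset (Fin n)) :
    f (pfaff (subMatrix M J)) = pfaff (subMatrix (M.map f) J) := map_pfaff f _

theorem commute_monomial_of_even {η γ : Fin n → R} (hγη : ∀ i j, γ i * η j = -(η j * γ i))
    (J K : Finset (Fin n)) (hK : Even K.card) : Commute (monomial γ J) (monomial η K) := by
  refine Commute.list_prod_left _ _ fun y hy => ?_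
  obtain ⟨p, rfl⟩ := List.mem_ofFn.mp hy
  have := mul_prod_ofFn_of_anticommute (γ (J.orderEmbOfFin rfl p))
    (fun q => η (K.orderEmbOfFin rfl q)) fun q => hγη _ _
  rw [hK.neg_one_pow, one_smul] at this
  exact this

end Expansions

/-! ### Phases in the coefficients and Pfaffians -/

section Scaling

variable {P : Type*} [Ring P] [Algebra ℝ P] {m n : ℕ}

theorem coeffC_tmul (s : Fin n → ℂ) (C : Matrix (Fin n) (Fin m) P) (I : Fin m → ℕ)
    (J : Finset (Fin n)) :
    coeffC (Matrix.of fun j i => s j ⊗ₜ[ℝ] C j i) I J = (∏ j ∈ J, s j) ⊗ₜ[ℝ] coeffC C I J := by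
  rw [coeffC, coeffC]
  split_ifs with h
  · rw [TensorProduct.tmul_smul, ← prod_orderEmbOfFin, ← phi_tmul]
    rfl
  · simp

theorem pfaff_subMatrix_tmul (s : Fin n → ℂ) (D : Matrix (Fin n) (Fin n) P)
    (J : Finset (Fin n)) :
    pfaff (subMatrix (Matrix.of fun j k => (s j * s k) ⊗ₜ[ℝ] D j k) J)
      = (∏ j ∈ J, s j) ⊗ₜ[ℝ] pfaff (subMatrix D J) := by
  rw [← prod_orderEmbOfFin, ← pfaff_tmul]
  rfl

end Scaling

/-! ### The integrand of the superPfaffian -/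

section Integrand

variable {V0 V1 : Type*} [AddCommGroup V0] [Module ℝ V0] [AddCommGroup V1] [Module ℝ V1]
  {P : Type*} [Ring P] [Algebra ℝ P] {𝒢 : ZMod 2 → Submodule ℝ P}
  {F : SymplecticForm V0 V1} {m n : ℕ}

theorem formA_mem (A : sp F ⊗[ℝ] 𝒢 0) (v w : V0) : formA A v w ∈ 𝒢 0 := contract_mem _ _ _

theorem formD_mem (D : so F ⊗[ℝ] 𝒢 0) (v w : V1) : formD D v w ∈ 𝒢 0 := contract_mem _ _ _

theorem formC_mem (BC : spoOdd F ⊗[ℝ] 𝒢 1) (v : V1) (w : V0) : formC BC v w ∈ 𝒢 1 :=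
  contract_mem _ _ _

/-- The coefficient contributes the phases of `J`, the Pfaffian those of the complement; together
they give the full product occurring in `topCoeff`. -/
theorem coeffC_mul_pfaff_mul (b : SymplecticBasis F m n) (X : SpoPoint F 𝒢) (I : Fin m → ℕ)
    (J : Finset (Fin n)) (y : P) :
    coeffC (matC b X.BC) I J * pfaff (subMatrix (matD b X.D) Jᶜ) * ((1 : ℂ) ⊗ₜ[ℝ] y)
      = (∏ j, b.s j) ⊗ₜ[ℝ] (coeffC (Matrix.of fun j i => formC X.BC (b.g j) (b.e i)) I J
        * pfaff (subMatrix (Matrix.of fun i j => formD X.D (b.g i) (b.g j)) Jᶜ) * y) := by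
  have hC : matC b X.BC = Matrix.of fun j i => b.s j ⊗ₜ[ℝ]
      (Matrix.of fun j i => formC X.BC (b.g j) (b.e i)) j i := by
    ext j i; exact matC_eq b X.BC j i
  have hD : matD b X.D = Matrix.of fun j k => (b.s j * b.s k) ⊗ₜ[ℝ]
      (Matrix.of fun i j => formD X.D (b.g i) (b.g j)) j k := by
    ext j k; exact matD_eq b X.D j k
  rw [hC, hD, coeffC_tmul, pfaff_subMatrix_tmul, Algebra.TensorProduct.tmul_mul_tmul,
    Algebra.TensorProduct.tmul_mul_tmul, mul_one, Finset.prod_mul_prod_compl]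

variable [GradedAlgebra 𝒢]

/-- Both mixed sums equal `-∑ η_j γ_j`, one by the Koszul sign and the other by
`formB_eq_neg_formC`, so the factor `-1/2` leaves `+∑ η_j γ_j`. -/
theorem mu_eq (b : SymplecticBasis F m n) (X : SpoPoint F 𝒢) (v0 : V0) :
    mu b X v0 = constHom V1 𝒢 ((-(1 / 2) : ℝ) • formA X.A v0 v0)
      + ∑ j, oddCoord 𝒢 (b.g.coord j) * constHom V1 𝒢 (formC X.BC (b.g j) v0)
      + (-1 / 2 : ℝ) • ∑ i, ∑ j, oddCoord 𝒢 (b.g.coord j) *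
        constHom V1 𝒢 (formD X.D (b.g i) (b.g j)) * oddCoord 𝒢 (b.g.coord i) := by
  have h1 : ∀ i, const 𝒢 V1 (formC X.BC (b.g i) v0) * oddCoord 𝒢 (b.g.coord i)
      = -(oddCoord 𝒢 (b.g.coord i) * constHom V1 𝒢 (formC X.BC (b.g i) v0)) := fun i =>
    constHom_mul_oddCoord_of_odd (formC_mem _ _ _) _
  have h2 : ∀ j, oddCoord 𝒢 (b.g.coord j) * const 𝒢 V1 (formB X.BC v0 (b.g j))
      = -(oddCoord 𝒢 (b.g.coord j) * constHom V1 𝒢 (formC X.BC (b.g j) v0)) := fun j => by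
    rw [formB_eq_neg_formC, const_eq, map_neg, mul_neg]
  rw [mu]
  simp only [h1, h2, Finset.sum_neg_distrib]
  simp only [const_eq, map_smul]
  module

variable [FiniteDimensional ℝ P] {β : P →ₐ[ℝ] ℝ}

theorem constHom_commute (hP : IsNear 𝒢 β) {p : P} (hp : p ∈ 𝒢 0) (x : FunAlg V1 𝒢) :
    Commute (constHom V1 𝒢 p) x := constHom_commute_of_even hp (hP.even_comm p hp) x

theorem funBody_mu (hP : IsNear 𝒢 β) (b : SymplecticBasis F m n) (X : SpoPoint F 𝒢) (v0 : V0) :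
    funBody 𝒢 β (mu b X v0) = β ((-(1 / 2) : ℝ) • formA X.A v0 v0) := by
  have h0 : ∀ p : P, funBody 𝒢 β (constHom V1 𝒢 p) = β p := fun p => by
    have := funBody_tmul (𝒢 := 𝒢) β (1 : ExteriorAlgebra ℝ (Module.Dual ℝ V1)) p
    rwa [map_one, map_one, one_mul, one_mul] at this
  have h1 : ∀ (η : Module.Dual ℝ V1) (p : P),
      funBody 𝒢 β (oddCoord 𝒢 η * constHom V1 𝒢 p) = 0 := fun η p => by
    rw [oddCoord_eq, funBody_tmul, ExteriorAlgebra.algebraMapInv, ExteriorAlgebra.lift_ι_apply]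
    simp
  have h2 : ∀ (η η' : Module.Dual ℝ V1) (p : P), p ∈ 𝒢 0 →
      funBody 𝒢 β (oddCoord 𝒢 η * constHom V1 𝒢 p * oddCoord 𝒢 η') = 0 := fun η η' p hp => by
    rw [mul_assoc, (constHom_commute hP hp _).eq, ← mul_assoc, oddCoord_eq, oddCoord_eq, ← map_mul,
      funBody_tmul, map_mul, ExteriorAlgebra.algebraMapInv, ExteriorAlgebra.lift_ι_apply]
    simp
  rw [mu_eq, map_add, map_add, h0]
  simp only [LinearMap.map_smul, map_sum, h1, h2 _ _ _ (formD_mem X.D _ _), Finset.sum_const_zero, smul_zero, add_zero]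

theorem superExp_mu (hP : IsNear 𝒢 β) (b : SymplecticBasis F m n) (X : SpoPoint F 𝒢) (v0 : V0) :
    superExp (funBody 𝒢 β) (mu b X v0) =
      nilExp (∑ j, oddCoord 𝒢 (b.g.coord j) * constHom V1 𝒢 (formC X.BC (b.g j) v0))
      * nilExp ((-1 / 2 : ℝ) • ∑ i, ∑ j, oddCoord 𝒢 (b.g.coord j) *
        constHom V1 𝒢 (formD X.D (b.g i) (b.g j)) * oddCoord 𝒢 (b.g.coord i))
      * constHom V1 𝒢 (superExp β.toLinearMap ((-(1 / 2) : ℝ) • formA X.A v0 v0)) := by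
  have hη : ∀ i j, oddCoord 𝒢 (b.g.coord i) * oddCoord 𝒢 (b.g.coord j)
      = -(oddCoord 𝒢 (b.g.coord j) * oddCoord 𝒢 (b.g.coord i)) := fun i j =>
    oddCoord_mul_oddCoord 𝒢 _ _
  have hγη : ∀ i j, constHom V1 𝒢 (formC X.BC (b.g i) v0) * oddCoord 𝒢 (b.g.coord j)
      = -(oddCoord 𝒢 (b.g.coord j) * constHom V1 𝒢 (formC X.BC (b.g i) v0)) := fun i j =>
    constHom_mul_oddCoord_of_odd (formC_mem _ _ _) _
  have hγ : ∀ i j, constHom V1 𝒢 (formC X.BC (b.g i) v0) * constHom V1 𝒢 (formC X.BC (b.g j) v0)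
      = -(constHom V1 𝒢 (formC X.BC (b.g j) v0) * constHom V1 𝒢 (formC X.BC (b.g i) v0)) :=
    fun i j => by
      rw [← map_mul, ← map_mul, ← map_neg,
        hP.odd_anticomm _ (formC_mem _ _ _) _ (formC_mem _ _ _)]
  have hM : ∀ i j (x : FunAlg V1 𝒢), Commute (constHom V1 𝒢 (formD X.D (b.g i) (b.g j))) x :=
    fun i j x => constHom_commute hP (formD_mem _ _ _) x
  set S := ∑ j, oddCoord 𝒢 (b.g.coord j) * constHom V1 𝒢 (formC X.BC (b.g j) v0)
  set Q := ∑ i, ∑ j, oddCoord 𝒢 (b.g.coord j) *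
        constHom V1 𝒢 (formD X.D (b.g i) (b.g j)) * oddCoord 𝒢 (b.g.coord i)
  set a := (-(1 / 2) : ℝ) • formA X.A v0 v0 with ha
  have haG : a ∈ 𝒢 0 := (𝒢 0).smul_mem _ (formA_mem _ _ _)
  let c := a - algebraMap ℝ P (β a)
  have hcG : c ∈ 𝒢 0 := (𝒢 0).sub_mem haG (SetLike.algebraMap_mem_graded 𝒢 _)
  have hc : IsNilpotent c := by
    have := hP.isLocalRing
    obtain ⟨N, hN⟩ := exists_pow_eq_zero_of_isLocalRing β
    exact ⟨N, hN _ (by simp [c])⟩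
  have hcomm : ∀ x : FunAlg V1 𝒢, Commute x (constHom V1 𝒢 c) := fun x =>
    (constHom_commute hP hcG x).symm
  have hSQ : Commute S ((-1 / 2 : ℝ) • Q) := by
    refine Commute.smul_right ?_ _
    refine Commute.sum_left _ _ _ fun k _ => Commute.sum_right _ _ _ fun i _ =>
      Commute.sum_right _ _ _ fun j _ => ?_
    -- An odd coordinate crosses two odd factors and the two signs cancel.
    have h1 : ∀ j, Commute (oddCoord 𝒢 (b.g.coord k) * constHom V1 𝒢 (formC X.BC (b.g k) v0))
        (oddCoord 𝒢 (b.g.coord j)) := fun j => by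
      rw [Commute, SemiconjBy, mul_assoc, hγη, mul_neg, ← mul_assoc, hη k j, neg_mul, neg_neg,
        mul_assoc]
    exact ((h1 j).mul_right (hM i j _).symm).mul_right (h1 i)
  have hSn : IsNilpotent S := ⟨_, sum_mul_pow_succ hη hγ hγη⟩
  have hQn : IsNilpotent ((-1 / 2 : ℝ) • Q) :=
    IsNilpotent.smul ⟨_, quadratic_pow_succ hη (Matrix.of fun i j =>
      constHom V1 𝒢 (formD X.D (b.g i) (b.g j))) hM⟩ _
  have hcn : IsNilpotent (constHom V1 𝒢 c) := hc.map _
  rw [superExp_eq, superExp_eq, funBody_mu hP, ← ha, AlgHom.toLinearMap_apply,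
    map_smul (constHom V1 𝒢), map_nilExp _ hc, ← nilExp_add hSQ hSn hQn, mul_smul_comm,
    ← nilExp_add (hcomm _) (hSQ.isNilpotent_add hSn hQn) hcn]
  congr 2
  rw [mu_eq, map_sub, AlgHom.commutes]
  abel

/-- The three signs come from separating `η` from `γ`, from the `-1/2` before the `D`-term, and from
the Berezin integral. For `k` even, `k(k-1)/2` has the parity of `k/2`, so with `n = 2a` and `r =
2c` the total exponent is congruent to `c + (a - c) + a = 2a`. -/
theorem sign_eq_one {n r : ℕ} (hn : Even n) (hr : Even r) (hle : r ≤ n) :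
    (-1 : ℝ) ^ (r * (r - 1) / 2) * (-1 : ℝ) ^ ((n - r) / 2) * (-1 : ℝ) ^ (n * (n - 1) / 2) = 1 := by
  obtain ⟨a, rfl⟩ := hn
  obtain ⟨c, rfl⟩ := hr
  have h : ∀ k : ℕ, (-1 : ℝ) ^ ((k + k) * (k + k - 1) / 2) = (-1 : ℝ) ^ k := fun k => by
    rw [show (k + k) * (k + k - 1) = 2 * (k * (k + k - 1)) by ring, Nat.mul_div_cancel_left _ two_pos,
      pow_mul]
    rcases Nat.eq_zero_or_pos k with rfl | hk
    · simp
    · rcases Nat.even_or_odd k with h | h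
      · simp [h.neg_one_pow]
      · rw [h.neg_one_pow, Odd.neg_one_pow]
        exact ⟨k - 1, by omega⟩
  rw [h, h, show (a + a - (c + c)) / 2 = a - c by omega, ← pow_add, ← pow_add, Even.neg_one_pow]
  exact ⟨a, by omega⟩

theorem spfIntegrand_eq_sum (hn : Even n) (hP : IsNear 𝒢 β) (b : SymplecticBasis F m n)
    (X : SpoPoint F 𝒢) (x : Fin m → ℝ) :
    spfIntegrand b β X x = ∑ J ∈ (Finset.univ : Finset (Finset (Fin n))) with Even J.card,
      eps J • ((∏ j, b.s j) ⊗ₜ[ℝ] (monomial (fun j => formC X.BC (b.g j) (b.point x)) J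
        * pfaff (subMatrix (Matrix.of fun i j => formD X.D (b.g i) (b.g j)) Jᶜ)
        * superExp β.toLinearMap ((-(1 / 2) : ℝ) • formA X.A (b.point x) (b.point x)))) := by
  have hη : ∀ i j, oddCoord 𝒢 (b.g.coord i) * oddCoord 𝒢 (b.g.coord j)
      = -(oddCoord 𝒢 (b.g.coord j) * oddCoord 𝒢 (b.g.coord i)) := fun i j =>
    oddCoord_mul_oddCoord 𝒢 _ _
  set v0 := b.point x
  have hγη : ∀ i j, constHom V1 𝒢 (formC X.BC (b.g i) v0) * oddCoord 𝒢 (b.g.coord j)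
      = -(oddCoord 𝒢 (b.g.coord j) * constHom V1 𝒢 (formC X.BC (b.g i) v0)) := fun i j =>
    constHom_mul_oddCoord_of_odd (formC_mem _ _ _) _
  have hγ : ∀ i j, constHom V1 𝒢 (formC X.BC (b.g i) v0) * constHom V1 𝒢 (formC X.BC (b.g j) v0)
      = -(constHom V1 𝒢 (formC X.BC (b.g j) v0) * constHom V1 𝒢 (formC X.BC (b.g i) v0)) :=
    fun i j => by
      rw [← map_mul, ← map_mul, ← map_neg,
        hP.odd_anticomm _ (formC_mem _ _ _) _ (formC_mem _ _ _)]
  let M : Matrix (Fin n) (Fin n) P := Matrix.of fun i j => formD X.D (b.g i) (b.g j)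
  have hM : ∀ i j (x : FunAlg V1 𝒢), Commute (M.map (constHom V1 𝒢) i j) x :=
    fun i j x => constHom_commute hP (formD_mem _ _ _) x
  have hexp := nilExp_quadratic hη (M.map (constHom V1 𝒢)) hM (-1)
  have hMij : ∀ i j, M.map (constHom V1 𝒢) i j = constHom V1 𝒢 (formD X.D (b.g i) (b.g j)) :=
    fun _ _ => rfl
  simp only [hMij] at hexp
  set E := superExp β.toLinearMap ((-(1 / 2) : ℝ) • formA X.A v0 v0)
  have hterm : ∀ J K : Finset (Fin n),
      berezin b ((-1 : ℝ) ^ (J.card * (J.card - 1) / 2) •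
        (monomial (fun j => oddCoord 𝒢 (b.g.coord j)) J
          * monomial (fun j => constHom V1 𝒢 (formC X.BC (b.g j) v0)) J)
        * (-1 : ℝ) ^ (K.card / 2) • (monomial (fun j => oddCoord 𝒢 (b.g.coord j)) K
          * pfaff (subMatrix (M.map (constHom V1 𝒢)) K)) * constHom V1 𝒢 E)
      = if K = Jᶜ then (if Even J.card then eps J • ((∏ j, b.s j) ⊗ₜ[ℝ]
          (monomial (fun j => formC X.BC (b.g j) v0) J * pfaff (subMatrix M Jᶜ) * E)) else 0) else 0 := fun J K => by
    have hcard : Jᶜ.card = n - J.card := by rw [Finset.card_compl, Fintype.card_fin]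
    have hle : J.card ≤ n := by simpa using Finset.card_le_univ J
    -- For `K` even, `γ^J` crosses `η^K` without sign; for `K` odd the Pfaffian vanishes. As `n` is
    -- even, `J` and its complement have the same parity.
    by_cases hK : Even K.card
    · have h1 : (-1 : ℝ) ^ (J.card * (J.card - 1) / 2) •
        (monomial (fun j => oddCoord 𝒢 (b.g.coord j)) J
          * monomial (fun j => constHom V1 𝒢 (formC X.BC (b.g j) v0)) J)
        * (-1 : ℝ) ^ (K.card / 2) • (monomial (fun j => oddCoord 𝒢 (b.g.coord j)) K
          * pfaff (subMatrix (M.map (constHom V1 𝒢)) K)) * constHom V1 𝒢 E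
        = ((-1 : ℝ) ^ (J.card * (J.card - 1) / 2) * (-1 : ℝ) ^ (K.card / 2)) •
          (monomial (fun j => oddCoord 𝒢 (b.g.coord j)) J
            * monomial (fun j => oddCoord 𝒢 (b.g.coord j)) K
            * constHom V1 𝒢 (monomial (fun j => formC X.BC (b.g j) v0) J * pfaff (subMatrix M K) * E)) := by
        rw [smul_mul_smul_comm, smul_mul_assoc, map_mul, map_mul, map_monomial, map_pfaff_subMatrix,
          mul_assoc (monomial _ J) (monomial _ J), ← mul_assoc (monomial _ J) (monomial _ K) (pfaff _),
          (commute_monomial_of_even hγη J K hK).eq]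
        simp only [mul_assoc]
      rw [h1, map_smul, berezin_monomial]
      split_ifs with hKJ hJ
      · subst hKJ
        have hsign := sign_eq_one hn hJ hle
        rw [← hcard] at hsign
        rw [smul_smul, ← mul_assoc, hsign, one_mul]
      · subst hKJ
        rw [hcard, Nat.even_sub hle] at hK
        exact absurd (hK.mp hn) hJ
      · rw [smul_zero]
    · rw [pfaff_eq_zero_of_odd _ hK, mul_zero, smul_zero, mul_zero, zero_mul, map_zero]
      split_ifs with hKJ hJ
      · subst hKJ
        rw [hcard, Nat.even_sub hle] at hK
        exact absurd ⟨fun _ => hJ, fun _ => hn⟩ hK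
      · rfl
      · rfl
  rw [spfIntegrand, superExp_mu hP, nilExp_sum_mul hη hγ hγη]
  rw [hexp, Finset.sum_mul_sum, Finset.sum_mul, map_sum]
  simp only [Finset.sum_mul, map_sum]
  rw [Finset.sum_congr rfl fun J _ => Finset.sum_congr rfl fun K _ => hterm J K]
  simp only [Finset.sum_ite_eq', Finset.mem_univ, if_true]
  rw [Finset.sum_filter]

theorem spfIntegrand_eq_sum_momentIntegrand (hn : Even n) (hP : IsNear 𝒢 β)
    (b : SymplecticBasis F m n) (X : SpoPoint F 𝒢) (x : Fin m → ℝ) :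
    spfIntegrand b β X x = ∑ J ∈ (Finset.univ : Finset (Finset (Fin n))) with Even J.card,
      ∑ I ∈ Finset.piAntidiag (Finset.univ : Finset (Fin m)) J.card,
        ((-1 : ℝ) ^ (J.card * (J.card - 1) / 2) * eps J) •
          (coeffC (matC b X.BC) I J * pfaff (subMatrix (matD b X.D) Jᶜ)
            * ((1 : ℂ) ⊗ₜ[ℝ] momentIntegrand b β X.A I x)) := by
  rw [spfIntegrand_eq_sum hn hP]
  refine Finset.sum_congr rfl fun J _ => ?_
  have h1 : (fun j => formC X.BC (b.g j) (b.point x)) = fun j => ∑ i, x i •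
      (Matrix.of fun j i => formC X.BC (b.g j) (b.e i)) j i :=
    funext fun j => formC_sum_smul _ _ _ _ _
  rw [h1, monomial_sum_smul, Finset.sum_mul, Finset.sum_mul, TensorProduct.tmul_sum,
    Finset.smul_sum]
  refine Finset.sum_congr rfl fun I _ => ?_
  rw [coeffC_mul_pfaff_mul, momentIntegrand]
  simp only [mul_smul_comm, smul_mul_assoc, TensorProduct.tmul_smul, smul_smul]
  congr 1
  ring

end Integrand

/-! ### Independence of the basis -/

section BasisChange

variable {V0 V1 : Type*} [AddCommGroup V0] [Module ℝ V0] [AddCommGroup V1] [Module ℝ V1]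
  {F : SymplecticForm V0 V1} {m n : ℕ}

/-- Applying the determinant of `b₀` to the equal orientations gives the ratio of the products of
phases, and this is also the ratio between the two determinant forms. -/
theorem topCoeff_eq_of_orientation_eq {b b₀ : SymplecticBasis F m n}
    (hor : b.orientation = b₀.orientation) : b.topCoeff = b₀.topCoeff := by
  let L : ExteriorAlgebra ℝ (Module.Dual ℝ V1) →ₗ[ℝ] ℝ :=
    ExteriorAlgebra.liftAlternating (R := ℝ)
      (Pi.single (M := fun k => Module.Dual ℝ V1 [⋀^Fin k]→ₗ[ℝ] ℝ) n b₀.g.dualBasis.det)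
  have hL : ∀ v : Fin n → Module.Dual ℝ V1,
      L (ExteriorAlgebra.ιMulti ℝ n v) = b₀.g.dualBasis.det v := fun v => by
    simp only [L]
    rw [ExteriorAlgebra.liftAlternating_apply_ιMulti, Pi.single_eq_same]
  have h := congrArg (fun t => TensorProduct.rid ℝ ℂ (L.lTensor ℂ t)) hor
  simp only [SymplecticBasis.orientation, LinearMap.lTensor_tmul, TensorProduct.rid_tmul, hL] at h
  have h1 : b₀.g.dualBasis.det (fun j => b₀.g.coord j) = 1 := by
    have : (fun j => b₀.g.coord j) = b₀.g.dualBasis := by funext j; simp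
    rw [this, Module.Basis.det_self]
  have hs : ∏ j, b.s j ≠ 0 := Finset.prod_ne_zero_iff.mpr fun j _ => s_ne_zero b j
  have hs₀ : ∏ j, b₀.s j ≠ 0 := Finset.prod_ne_zero_iff.mpr fun j _ => s_ne_zero b₀ j
  rw [h1, one_smul, Complex.real_smul] at h
  apply ExteriorAlgebra.lhom_ext
  intro k
  ext v
  simp only [LinearMap.compAlternatingMap_apply]
  by_cases hk : k = n
  · subst hk
    rw [topCoeff_ιMulti, topCoeff_ιMulti]
    have h2 := congrArg (fun f => f v) (b₀.g.dualBasis.det.eq_smul_basis_det b.g.dualBasis)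
    have h3 : (fun j => b.g.coord j) = b.g.dualBasis := by funext j; simp
    rw [h3] at h
    simp only [AlternatingMap.smul_apply, smul_eq_mul] at h2
    rw [h2, Complex.real_smul, Complex.real_smul, Complex.ofReal_mul]
    field_simp at h
    rw [← h]
    ring
  · rw [topCoeff_ιMulti_of_ne b hk, topCoeff_ιMulti_of_ne b₀ hk]

/-- The sum contracts `Φ` with the canonical element of `V1 ⊗ V1^*`, which does not depend on the
basis. -/
theorem sum_basis_coord_eq {E : Type*} [AddCommGroup E] [Module ℝ E]
    (g g' : Module.Basis (Fin n) ℝ V1) (Φ : V1 →ₗ[ℝ] Module.Dual ℝ V1 →ₗ[ℝ] E) :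
    ∑ i, Φ (g i) (g.coord i) = ∑ i, Φ (g' i) (g'.coord i) := by
  have h1 : ∀ i, Φ (g i) (g.coord i) = ∑ k, Φ (g' k) (g'.coord k (g i) • g.coord i) := fun i => by
    conv_lhs => rw [← g'.sum_repr (g i)]
    simp only [map_sum, map_smul, LinearMap.sum_apply, LinearMap.smul_apply]
    rfl
  simp only [h1]
  rw [Finset.sum_comm]
  refine Finset.sum_congr rfl fun k _ => ?_
  rw [← map_sum]
  congr 1
  exact g.sum_dual_apply_smul_coord (g'.coord k)

variable {P : Type*} [Ring P] [Algebra ℝ P] {𝒢 : ZMod 2 → Submodule ℝ P} [GradedAlgebra 𝒢]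

/-- The linear map `w ↦ B(w, C v)`. -/
def formCLin (BC : spoOdd F ⊗[ℝ] 𝒢 1) (v : V0) : V1 →ₗ[ℝ] P where
  toFun w := formC BC w v
  map_add' w w' := by
    simp only [formC, map_add, LinearMap.add_comp, contract_add]
  map_smul' c w := by
    simp only [formC, map_smul, LinearMap.smul_comp, contract_smul, RingHom.id_apply]

/-- The bilinear map `(w, w') ↦ B(w, D w')`. -/
def formDLin (D : so F ⊗[ℝ] 𝒢 0) : V1 →ₗ[ℝ] V1 →ₗ[ℝ] P :=
  LinearMap.mk₂ ℝ (fun w w' => formD D w w')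
    (fun w w' u => by simp only [formD, map_add, LinearMap.add_comp, contract_add])
    (fun c w u => by simp only [formD, map_smul, LinearMap.smul_comp, contract_smul])
    (fun w u u' => by
      simp only [formD, map_add, LinearMap.add_comp, LinearMap.comp_add, contract_add])
    (fun c w u => by
      simp only [formD, map_smul, LinearMap.smul_comp, LinearMap.comp_smul, contract_smul])

variable (𝒢) in
/-- The linear map `η ↦ η ⊗ 1`. -/
def oddCoordLin : Module.Dual ℝ V1 →ₗ[ℝ] FunAlg V1 𝒢 :=
  (oddHom 𝒢).toLinearMap.comp (ExteriorAlgebra.ι ℝ)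

theorem mu_eq_mu (b b₀ : SymplecticBasis F m n) (X : SpoPoint F 𝒢) (v0 : V0) :
    mu b X v0 = mu b₀ X v0 := by
  let mulL := LinearMap.mul ℝ (FunAlg V1 𝒢)
  let cst := (constHom V1 𝒢).toLinearMap
  have hS := sum_basis_coord_eq b.g b₀.g
    ((mulL.flip.comp (cst.comp (formCLin X.BC v0))).compl₂ (oddCoordLin 𝒢))
  have hQ1 : ∀ w η, ∑ j, oddCoord 𝒢 (b.g.coord j) * constHom V1 𝒢 (formD X.D w (b.g j))
        * oddCoord 𝒢 η
      = ∑ j, oddCoord 𝒢 (b₀.g.coord j) * constHom V1 𝒢 (formD X.D w (b₀.g j))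
        * oddCoord 𝒢 η := fun w η => by
    rw [← Finset.sum_mul, ← Finset.sum_mul]
    congr 1
    exact sum_basis_coord_eq b.g b₀.g
      ((mulL.flip.comp (cst.comp (formDLin X.D w))).compl₂ (oddCoordLin 𝒢))
  have hQ2 : ∀ w η, ∑ i, oddCoord 𝒢 η * constHom V1 𝒢 (formD X.D (b.g i) w)
        * oddCoord 𝒢 (b.g.coord i)
      = ∑ i, oddCoord 𝒢 η * constHom V1 𝒢 (formD X.D (b₀.g i) w)
        * oddCoord 𝒢 (b₀.g.coord i) := fun w η => by
    simp only [mul_assoc]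
    rw [← Finset.mul_sum, ← Finset.mul_sum]
    congr 1
    exact sum_basis_coord_eq b.g b₀.g
      ((mulL.comp (cst.comp ((formDLin X.D).flip w))).compl₂ (oddCoordLin 𝒢))
  rw [mu_eq, mu_eq]
  -- In the double sum the basis is changed in one index at a time.
  refine congrArg₂ _ (congrArg₂ _ rfl hS) (congrArg _ ?_)
  · simp only [hQ1]
    exact (Finset.sum_comm.trans (Finset.sum_congr rfl fun j _ =>
      hQ2 (b₀.g j) (b₀.g.coord j))).trans Finset.sum_comm

theorem spfIntegrand_eq_of_point_eq {b b₀ : SymplecticBasis F m n}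
    (hor : b.orientation = b₀.orientation) (β : P →ₐ[ℝ] ℝ) (X : SpoPoint F 𝒢)
    {x y : Fin m → ℝ} (h : b.point y = b₀.point x) :
    spfIntegrand b₀ β X x = spfIntegrand b β X y := by
  rw [spfIntegrand, spfIntegrand, h, mu_eq_mu b b₀, berezin, berezin,
    topCoeff_eq_of_orientation_eq hor]

/-- The change of coordinates between two symplectic bases preserves the volume. -/
theorem exists_abs_det_eq_one (b b₀ : SymplecticBasis F m n) :
    ∃ T : (Fin m → ℝ) →ₗ[ℝ] (Fin m → ℝ), |LinearMap.det T| = 1 ∧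
      ∀ x, b.point (T x) = b₀.point x := by
  let M := b.e.toMatrix b₀.e
  refine ⟨Matrix.toLin' M, ?_, fun x => ?_⟩
  · have h1 := LinearMap.BilinForm.toMatrix_mul_basis_toMatrix b.e b₀.e F.B0
    -- Both symplectic bases have the same Gram matrix `Ω`, so `Mᵀ Ω M = Ω` and `(det M)² = 1`.
    have h2 : LinearMap.BilinForm.toMatrix b₀.e F.B0 = LinearMap.BilinForm.toMatrix b.e F.B0 := by
      ext i j
      simp only [LinearMap.BilinForm.toMatrix_apply, b.e_symplectic, b₀.e_symplectic]
    have h3 : (LinearMap.BilinForm.toMatrix b.e F.B0).det ≠ 0 :=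
      (LinearMap.BilinForm.nondegenerate_iff_det_ne_zero b.e).mp F.nondegenerate0
    rw [h2] at h1
    have h4 := congrArg Matrix.det h1
    rw [Matrix.det_mul, Matrix.det_mul, Matrix.det_transpose] at h4
    rw [LinearMap.det_toLin']
    have h5 : M.det * M.det = 1 := by
      apply mul_right_cancel₀ h3
      rw [one_mul]
      linear_combination h4
    rcases mul_self_eq_one_iff.mp h5 with h | h <;> simp [h]
  · simp only [SymplecticBasis.point, Matrix.toLin'_apply, Matrix.mulVec, dotProduct,
      Finset.sum_smul]
    rw [Finset.sum_comm]
    refine Finset.sum_congr rfl fun j _ => ?_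
    conv_rhs => rw [← b.e.sum_repr (b₀.e j), Finset.smul_sum]
    refine Finset.sum_congr rfl fun i _ => ?_
    rw [smul_smul, mul_comm]
    rfl

end BasisChange

end SuperPfaffian

end

/-! ### Integration of the expansion -/

theorem mainTheorem12
    {V0 V1 P : Type*} [AddCommGroup V0] [Module ℝ V0] [AddCommGroup V1] [Module ℝ V1]
    [Ring P] [Algebra ℝ P] [FiniteDimensional ℝ P]
    (F : SuperPfaffian.SymplecticForm V0 V1) {m n : ℕ} (hn : Even n)
    (b₀ b : SuperPfaffian.SymplecticBasis F m n) (hor : b.orientation = b₀.orientation)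
    (𝒢 : ZMod 2 → Submodule ℝ P) [GradedAlgebra 𝒢]
    (β : P →ₐ[ℝ] ℝ) (hP : SuperPfaffian.IsNear 𝒢 β)
    (X : SuperPfaffian.SpoPoint F 𝒢) (hX : X.InVPlus β) :
    SuperPfaffian.WeaklyIntegrable (SuperPfaffian.spfIntegrand b₀ β X) ∧
    (∀ I : Fin m → ℕ, SuperPfaffian.WeaklyIntegrable
      (SuperPfaffian.momentIntegrand b β X.A I)) ∧
    SuperPfaffian.spf b₀ β X =
      ∑ J ∈ (Finset.univ : Finset (Finset (Fin n))) with Even J.card,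
        ∑ I ∈ Finset.piAntidiag (Finset.univ : Finset (Fin m)) J.card,
          ((-1 : ℝ) ^ (J.card * (J.card - 1) / 2) * SuperPfaffian.eps J) •
            (SuperPfaffian.coeffC (SuperPfaffian.matC b X.BC) I J
              * SuperPfaffian.pfaff (SuperPfaffian.subMatrix (SuperPfaffian.matD b X.D) Jᶜ)
              * ((1 : ℂ) ⊗ₜ[ℝ] SuperPfaffian.moment b β X.A I)) := by
  open SuperPfaffian in
  have := hP.isLocalRing
  have hmom : ∀ I : Fin m → ℕ, WeaklyIntegrable (momentIntegrand b β X.A I) := fun I =>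
    weaklyIntegrable_momentIntegrand b β X.A hX I
  -- Each summand is a fixed linear map applied to the moment integrand, so it commutes with
  -- integration.
  let L (J : Finset (Fin n)) (I : Fin m → ℕ) : P →ₗ[ℝ] ℂ ⊗[ℝ] P :=
    ((-1 : ℝ) ^ (J.card * (J.card - 1) / 2) * eps J) •
      (LinearMap.mulLeft ℝ (coeffC (matC b X.BC) I J * pfaff (subMatrix (matD b X.D) Jᶜ))).comp
        (TensorProduct.mk ℝ ℂ P 1)
  have hfun : spfIntegrand b β X = fun x =>
      ∑ J ∈ (Finset.univ : Finset (Finset (Fin n))) with Even J.card,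
        ∑ I ∈ Finset.piAntidiag (Finset.univ : Finset (Fin m)) J.card,
          L J I (momentIntegrand b β X.A I x) :=
    funext fun x => spfIntegrand_eq_sum_momentIntegrand hn hP b X x
  have hint : WeaklyIntegrable (spfIntegrand b β X) := by
    rw [hfun]
    exact WeaklyIntegrable.sum fun J _ => WeaklyIntegrable.sum fun I _ => (hmom I).map (L J I)
  -- The integral defined by `b₀` is carried to the coordinates of `b`, where the expansion is
  -- available.
  obtain ⟨T, hT, hpt⟩ := exists_abs_det_eq_one b b₀
  have h₀ : spfIntegrand b₀ β X = fun x => spfIntegrand b β X (T x) :=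
    funext fun x => spfIntegrand_eq_of_point_eq hor β X (hpt x)
  refine ⟨?_, hmom, ?_⟩
  · rw [h₀]
    exact weaklyIntegrable_comp_linearMap hint hT
  · rw [spf, h₀, weakIntegral_comp_linearMap hint hT, hfun,
      weakIntegral_sum fun J _ => WeaklyIntegrable.sum fun I _ => (hmom I).map (L J I),
      Finset.smul_sum]
    refine Finset.sum_congr rfl fun J _ => ?_
    rw [weakIntegral_sum fun I _ => (hmom I).map (L J I), Finset.smul_sum]
    refine Finset.sum_congr rfl fun I _ => ?_
    rw [weakIntegral_map (hmom I), ← map_smul]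
    rfl
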